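/- \textbf{Setting.} An \emph{arena} consists of a finite set of states $S=S_1\uplus S_2$ (player $i$ controls $S_i$), a finite set $A$ of actions, a nonempty set $A(s)\subseteq A$ of available actions for each state $s$, and, for each $s$ and $a\in A(s)$, a probability distribution $\delta(s,a)$ on $S$ and a color $\mathrm{col}(s,a)\in\mathbb{N}$. It is \emph{deterministic} if every $\delta(s,a)$ has a one-point support, and a \emph{one-player arena of player $i$} if $|A(s)|=1$ for each state $s$ of the other player. An \emph{initialized arena} $(\mathcal A,S_{\mathrm{init}})$ is an arena with a nonempty set of initial states from which all states are reachable. A \emph{history} $\rho$ is a finite sequence $s_0a_1s_1\dots a_ns_n$ with $a_{j}\in A(s_{j-1})$ and $\delta(s_{j-1},a_{j})(s_{j})>0$; its word of colors is $\widehat{\mathrm{col}}(\rho)=\mathrm{col}(s_0,a_1)\dots\mathrm{col}(s_{n-1},a_n)$ and its last state is $\mathrm{out}(\rho)=s_n$. A \emph{(general) strategy} of player $i$ maps each history starting in $S_{\mathrm{init}}$ and ending in $S_i$ to a probability distribution on the actions available in its last state. It is \emph{pure} if all these distributions have one-point supports, \emph{memoryless} if they depend only on the last state, and \emph{based on $\mathcal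 M_{\max}$} if they depend only on the last state and on the greatest color seen so far, i.e. on the state after reading $\widehat{\mathrm{col}}(\rho)$ of the memory skeleton $\mathcal M_{\max}=(\mathbb N,0,(m,c)\mapsto\max\{m,c\})$. Strategies $\sigma_1,\sigma_2$ of the two players and a state $s$ induce a probability distribution $\mathsf{P}_{s}^{\sigma_1,\sigma_2}$ on infinite words of colors in $\mathbb{N}^\omega$. The \emph{weak parity} condition is $W=\{c_1c_2\ldots\in\mathbb{N}^\omega \mid \max_{j\ge1}c_j\text{ exists and is even}\}$; player 1 wants to maximize, and player 2 to minimize, the probability of $W$. For a finite word $w$ of colors, the game \emph{with past $w$} is the one in which $W$ is replaced by $\{w'\mid ww'\in W\}$. Let $\mathsf X$ stand for ``pure'' or ``general''. In a game with past $w$, an $\mathsf X$ strategy $\sigma_1$ of player 1 is \emph{$\mathsf X$-optimal from $S_{\mathrm{init}}$} if for every $\mathsf X$ strategy $\sigma_1'$ of player 1 and every $s\in S_{\mathrm{init}}$, $U(\sigma_1)\subseteq U(\sigma_1')$, where $U(\sigma)$ is the set of probability distributions $\mu$ on $\mathbb{N}^\omega$ such that some $\mathsf X$ strategy $\sigma_2$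 of player 2 satisfies $\mathsf{P}_s^{\sigma,\sigma_2}(\{w'\mid ww'\in W\})\le\mu(\{w'\mid ww'\in W\})$; optimality for player 2 is defined symmetrically. When no past is mentioned, $w$ is empty. A strategy $\sigma$ is \emph{$\mathsf X$-subgame perfect} if for every history $\rho$ starting in $S_{\mathrm{init}}$, the strategy $\rho'\mapsto\sigma(\rho\rho')$ is $\mathsf X$-optimal from $\{\mathrm{out}(\rho)\}$ in the game with past $\widehat{\mathrm{col}}(\rho)$. \textbf{Theorem.} \begin{enumerate} \item In every initialized deterministic two-player arena, each player has a pure memoryless strategy that, for the weak parity condition, is optimal and subgame perfect, both among pure strategies and among general strategies. \item In every initialized stochastic two-player arena, each player has a pure strategy based on $\mathcal M_{\max}$ that, for the weak parity condition, is optimal and subgame perfect among general strategies. \item Memory is needed in stochastic arenas: there is an initialized one-player stochastic arena of player 1 with a single initial state in which some pure strategy of player 1 based on $\mathcal M_{\max}$ wins (satisfies $W$) with probability $\tfrac34$, but no memoryless strategy of player 1, even randomized, is optimal among general strategies. \end{enumerate} -/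

import Mathlib

open MeasureTheory ProbabilityTheory

universe u v

namespace WeakParityGame

/-- The two players. -/
inductive Player : Type
  | one
  | two

/-- A move `(a, t)`: an action together with the state reached by it. Histories and plays from a
state `s` are finite lists, resp. infinite sequences, of moves: `s a₁ s₁ a₂ s₂ …` is
`s` followed by `(a₁, s₁), (a₂, s₂), …`. -/
def Move (S : Type u) (A : Type v) : Type (max u v) := A × S

instance (S : Type u) (A : Type v) : MeasurableSpace (Move S A) := ⊤

instance (S : Type u) (A : Type v) : DiscreteMeasurableSpace (Move S A) := ⟨fun _ => trivial⟩

instance (S : Type u) (A : Type v) [Finite S] [Finite A] : Finite (Move S A) :=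
  inferInstanceAs (Finite (A × S))

/-- A (two-player stochastic turn-based) arena with colors in `ℕ`. Finiteness of the state space
`S` and of the action set `A` is assumed wherever it is needed. `owner` says who controls a state;
`avail s` is the set of available actions in `s`; the values of `δ s a` and `col s a` are
only meaningful for `a ∈ avail s` (transition function and coloring are partial functions). -/
structure Arena (S : Type u) (A : Type v) where
  owner : S → Player
  avail : S → Set A
  δ : S → A → PMF S
  col : S → A → ℕ
  avail_nonempty : ∀ s, (avail s).Nonempty

/-- A (raw) strategy: to a history, given by its first state and its list of moves, it assigns a
distribution over actions. Which histories matter is fixed by `IsStrategy`. -/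
abbrev Strat (S : Type u) (A : Type v) : Type (max u v) := S → List (Move S A) → PMF A

/-- Last state of the history that starts in `s` and has the list of moves `l`. -/
def lastState {S : Type u} {A : Type v} : S → List (Move S A) → S
  | s, [] => s
  | _, m :: l => lastState m.2 l

/-- The strategy `σ` shifted by the history `(s, l)`: it plays after a continuation `l'` as `σ`
does after the whole history. (It only matters on histories starting in `lastState s l`.) -/
def shiftStrat {S : Type u} {A : Type v} (σ : Strat S A) (s : S) (l : List (Move S A)) :
    Strat S A :=
  fun _ l' => σ s (l ++ l')

/-- Types of strategies considered: pure strategies, and general (possibly randomized) ones. -/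
inductive StratType : Type
  | pure
  | general

/-! ### Memory skeletons -/

/-- A memory skeleton over the colors `ℕ`: on finitely many colors, only finitely many memory
states are reachable from the initial one. -/
structure MemorySkeleton where
  M : Type
  init : M
  upd : M → ℕ → M
  finite_reachable : ∀ B : Finset ℕ,
    {m : M | ∃ w : List ℕ, (∀ c ∈ w, c ∈ B) ∧ w.foldl upd init = m}.Finite

/-- The skeleton `(ℕ, 0, max)`, which remembers the greatest color seen. -/
def maxSkeleton : MemorySkeleton where
  M := ℕ
  init := 0
  upd := max
  finite_reachable := by
    intro B
    refine (insert 0 B).finite_toSet.subset ?_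
    have key : ∀ (w : List ℕ) (m : ℕ), m ∈ insert 0 B → (∀ c ∈ w, c ∈ B) →
        w.foldl max m ∈ insert 0 B := by
      intro w
      induction w with
      | nil => intro m hm _; simpa using hm
      | cons c w ih =>
        intro m hm hw
        refine ih (max m c) ?_ (fun c' hc' => hw c' (List.mem_cons_of_mem _ hc'))
        rcases max_choice m c with h | h <;> rw [h]
        · exact hm
        · exact Finset.mem_insert_of_mem (hw c List.mem_cons_self)
    rintro m ⟨w, hw, rfl⟩
    exact key w 0 (Finset.mem_insert_self _ _) hw

/-! ### Preference relations -/

/-- A relation between distributions over infinite words of colors. -/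
abbrev Pref : Type := Measure (ℕ → ℕ) → Measure (ℕ → ℕ) → Prop

/-- The preference relation induced by a winning condition `W`. -/
def prefOf (W : Set (ℕ → ℕ)) : Pref := fun μ μ' => μ W ≤ μ' W

/-- The infinite word `w w'`. -/
def prepend (w : List ℕ) (w' : ℕ → ℕ) : ℕ → ℕ :=
  fun n => if h : n < w.length then w[n] else w' (n - w.length)

/-- The shifted preference relation: `μ ⊑_{[w]} μ'` iff `wμ ⊑ wμ'`. -/
def shiftPref (pref : Pref) (w : List ℕ) : Pref :=
  fun μ μ' => pref (μ.map (prepend w)) (μ'.map (prepend w))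

/-- The weak parity winning condition: the greatest color seen exists and is even. -/
def weakParity : Set (ℕ → ℕ) := {c | ∃ m, IsGreatest (Set.range c) m ∧ Even m}

namespace Arena

variable {S : Type u} {A : Type v} (G : Arena S A)

/-! ### Histories -/

/-- `G.IsPath s l`: the state `s` followed by the moves `l` is a history of `G`. -/
def IsPath : S → List (Move S A) → Prop
  | _, [] => True
  | s, m :: l => m.1 ∈ G.avail s ∧ 0 < G.δ s m.1 m.2 ∧ IsPath m.2 l

/-- The sequence of colors of a history. -/
def colHist : S → List (Move S A) → List ℕ
  | _, [] => []
  | s, m :: l => G.col s m.1 :: colHist m.2 l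

/-- The state after `n` moves of the play `π` from `s`. -/
def stateAt (s : S) (π : ℕ → Move S A) : ℕ → S
  | 0 => s
  | n + 1 => (π n).2

/-- The infinite sequence of colors of the play `π` from `s`. -/
def colPlay (s : S) (π : ℕ → Move S A) : ℕ → ℕ :=
  fun n => G.col (stateAt s π n) (π n).1

/-- `(G, I)` is an initialized arena: there is an initial state, and every state is reachable
from the initial states. -/
def IsInitialized (I : Set S) : Prop :=
  I.Nonempty ∧ ∀ t, ∃ s ∈ I, ∃ l, G.IsPath s l ∧ lastState s l = t

/-- All transitions are deterministic. -/
def IsDeterministic : Prop :=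
  ∀ s, ∀ a ∈ G.avail s, ∃ t, (G.δ s a).support = {t}

/-- One-player arena of player `i`: the other player never has a choice. -/
def IsOnePlayer (i : Player) : Prop :=
  ∀ s, G.owner s ≠ i → ∃ a, G.avail s = {a}

/-! ### Strategies -/

/-- `(s, l)` is a history from the initial states `I` whose last state is controlled by `i`. -/
def IsHistOf (I : Set S) (i : Player) (s : S) (l : List (Move S A)) : Prop :=
  s ∈ I ∧ G.IsPath s l ∧ G.owner (lastState s l) = i

/-- `σ` is a strategy of player `i` on `(G, I)`. -/
def IsStrategy (I : Set S) (i : Player) (σ : Strat S A) : Prop :=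
  ∀ s l, G.IsHistOf I i s l → (σ s l).support ⊆ G.avail (lastState s l)

/-- `σ` does not randomize. -/
def IsPure (I : Set S) (i : Player) (σ : Strat S A) : Prop :=
  ∀ s l, G.IsHistOf I i s l → ∃ a, (σ s l).support = {a}

/-- `σ` only depends on the current state. -/
def IsMemoryless (I : Set S) (i : Player) (σ : Strat S A) : Prop :=
  ∀ s l s' l', G.IsHistOf I i s l → G.IsHistOf I i s' l' →
    lastState s l = lastState s' l' → σ s l = σ s' l'

/-- `σ` is based on the memory skeleton `K`, that is, encoded by a Mealy machine on `K`. -/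
def IsBasedOn (K : MemorySkeleton) (I : Set S) (i : Player) (σ : Strat S A) : Prop :=
  ∃ nxt : S → K.M → PMF A,
    (∀ s m, G.owner s = i → (nxt s m).support ⊆ G.avail s) ∧
    ∀ s l, G.IsHistOf I i s l →
      σ s l = nxt (lastState s l) ((G.colHist s l).foldl K.upd K.init)

/-- The strategies of type `X` of player `i` on `(G, I)`. -/
def strategies (X : StratType) (I : Set S) (i : Player) : Set (Strat S A) :=
  {σ | G.IsStrategy I i σ ∧ (X = StratType.pure → G.IsPure I i σ)}

/-! ### Outcomes -/

/-- Distribution of the next move after the history `(s, l)`: the player controlling the last state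
picks an action, and then the next state is drawn. -/
noncomputable def step (σ₁ σ₂ : Strat S A) (s : S) (l : List (Move S A)) : PMF (Move S A) :=
  (match G.owner (lastState s l) with
    | Player.one => σ₁ s l
    | Player.two => σ₂ s l).bind
  fun a => (G.δ (lastState s l) a).map fun t => ((a, t) : A × S)

variable [Finite S] [Finite A]

/-- The kernel that draws move number `n + 1` given the moves number `0, …, n`. -/
noncomputable def stepKernel (σ₁ σ₂ : Strat S A) (s : S) (n : ℕ) :
    Kernel (Π _ : Finset.Iic n, Move S A) (Move S A) :=
  Kernel.ofFunOfCountable fun h =>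
    (G.step σ₁ σ₂ s
      (List.ofFn fun k : Fin (n + 1) => h ⟨k, Finset.mem_Iic.2 (Nat.lt_succ_iff.1 k.2)⟩)).toMeasure

instance (σ₁ σ₂ : Strat S A) (s : S) (n : ℕ) : IsMarkovKernel (G.stepKernel σ₁ σ₂ s n) :=
  ⟨fun _ => PMF.toMeasure.isProbabilityMeasure _⟩

/-- The distribution over plays from `s` induced by the two strategies (Ionescu-Tulcea). -/
noncomputable def playMeasure (s : S) (σ₁ σ₂ : Strat S A) : Measure (ℕ → Move S A) :=
  (G.step σ₁ σ₂ s []).toMeasure.bind fun m =>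
    Kernel.traj (X := fun _ => Move S A) (G.stepKernel σ₁ σ₂ s) 0 fun _ => m

/-- The induced distribution over infinite words of colors. -/
noncomputable def outcome (s : S) (σ₁ σ₂ : Strat S A) : Measure (ℕ → ℕ) :=
  (G.playMeasure s σ₁ σ₂).map (G.colPlay s)

/-! ### Optimality -/

/-- Distributions that are at least as good for player one as what player two can induce against
`σ₁` from `s`. -/
def UCol (pref : Pref) (X : StratType) (s : S) (σ₁ : Strat S A) : Set (Measure (ℕ → ℕ)) :=
  {μ | IsProbabilityMeasure μ ∧
    ∃ σ₂ ∈ G.strategies X {s} Player.two, pref (G.outcome s σ₁ σ₂) μ}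

/-- Distributions that are at least as good for player two as what player one can induce against
`σ₂` from `s`. -/
def DCol (pref : Pref) (X : StratType) (s : S) (σ₂ : Strat S A) : Set (Measure (ℕ → ℕ)) :=
  {μ | IsProbabilityMeasure μ ∧
    ∃ σ₁ ∈ G.strategies X {s} Player.one, pref μ (G.outcome s σ₁ σ₂)}

/-- `σ` is at least as good as `σ'` from `s` for player `i`, under strategies of type `X`. -/
def AtLeastAsGood (pref : Pref) (X : StratType) (s : S) : Player → Strat S A → Strat S A → Prop
  | Player.one, σ, σ' => G.UCol pref X s σ ⊆ G.UCol pref X s σ'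
  | Player.two, σ, σ' => G.DCol pref X s σ ⊆ G.DCol pref X s σ'

/-- `σ` is an `X`-optimal strategy of player `i` in the initialized game `(G, I, pref)`. -/
def IsOptimal (pref : Pref) (X : StratType) (I : Set S) (i : Player) (σ : Strat S A) : Prop :=
  σ ∈ G.strategies X I i ∧
    ∀ σ' ∈ G.strategies X I i, ∀ s ∈ I, G.AtLeastAsGood pref X s i σ σ'

/-- `σ` is an `X`-subgame perfect strategy of player `i` in the initialized game `(G, I, pref)`:
after every history, it is `X`-optimal in the remaining game. -/
def IsSubgamePerfect (pref : Pref) (X : StratType) (I : Set S) (i : Player) (σ : Strat S A) :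
    Prop :=
  σ ∈ G.strategies X I i ∧
    ∀ s ∈ I, ∀ l, G.IsPath s l →
      G.IsOptimal (shiftPref pref (G.colHist s l)) X {lastState s l} i (shiftStrat σ s l)

end Arena

end WeakParityGame

open WeakParityGame

/-! A position is summarized by its state and the greatest color `m` seen so far. This level never
decreases and takes finitely many values, and a play that stays at level `m` forever is lost by
exactly one player, the one for whom `m` is bad. Values are therefore built from the top level
downwards. Once the levels above `m` are known, the value at `m` for the player for whom `m` is bad
is the least solution of the optimality equation (`exists_solution`, `exists_value`): least, because
never leaving `m` is worth nothing to that player.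

The optimality equation alone does not make a player win, since value-preserving actions may
postpone the level change forever. Leastness excludes this: it yields a rank such that at bad
levels, from positive value, every action that matters has a chance to raise the level or lower the
rank (`exists_rank`). Value, rank and chosen actions form a certificate (`IsCertificate`). By
`IsCertificate.le_measureReal_winEvent`, following a certificate guarantees the certified
probability against every opponent: the value minus a small multiple of a bounded potential is a
submartingale that grows by a fixed amount at each bad position where it is positive, so the
probabilities of such visits are summable.

Both players have certificates, with values summing to one, and these are valid for every past.
Hence playing a certificate is optimal after every history (`atLeastAsGood_of_follows`,
`playStrat_optimal`), which gives optimality and subgame perfection together.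

In deterministic arenas all values are 0 or 1, and pasts are linearly ordered by how hard they make
winning, an order that reading further colors preserves. A player can thus act in each state as if
the past were the hardest one from which that state is still won; this forgets the actual past
(`IsDeterministic.exists_memoryless_certificate`).

For the lower bound, `CoinState.arena` tosses a coin that decides between greatest color 1 and 2
before a choice between stopping and a second toss. Stopping is right after 2 only; any fixed
mixture wins with probability at most 1/2, against 3/4 with memory. -/

namespace WeakParityGame

/-! ### Finite prefixes of plays and their one-step evolution -/

/-- The first `n` moves of a play. -/
def prefixList {M : Type*} (n : ℕ) (π : ℕ → M) : List M := List.ofFn fun k : Fin n => π k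

@[simp] lemma prefixList_zero {M : Type*} (π : ℕ → M) : prefixList 0 π = [] := rfl

lemma prefixList_succ {M : Type*} (n : ℕ) (π : ℕ → M) :
    prefixList (n + 1) π = prefixList n π ++ [π n] := by
  simp only [prefixList, List.ofFn_succ']
  simp

namespace Arena

variable {S : Type u} {A : Type v} (G : Arena S A) [Finite S] [Finite A]

instance (s : S) (σ₁ σ₂ : Strat S A) : IsProbabilityMeasure (G.playMeasure s σ₁ σ₂) := by
  unfold playMeasure
  refine isProbabilityMeasure_bind (by fun_prop) ?_
  filter_upwards with m
  infer_instance

lemma measurable_prefixFun (n : ℕ) (F : List (Move S A) → ℝ) :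
    Measurable fun π : ℕ → Move S A => F (prefixList n π) := by
  have : (fun π : ℕ → Move S A => F (prefixList n π)) =
      (fun h : Fin n → Move S A => F (List.ofFn h)) ∘ fun π k => π k := rfl
  rw [this]
  exact (measurable_of_countable _).comp (by fun_prop)

lemma integrable_prefixFun (μ : Measure (ℕ → Move S A)) [IsFiniteMeasure μ] (n : ℕ)
    (F : List (Move S A) → ℝ) : Integrable (fun π => F (prefixList n π)) μ := by
  have h : Integrable (fun h : Fin n → Move S A => F (List.ofFn h)) (μ.map fun π k => π k) :=
    Integrable.of_finite
  exact h.comp_measurable (by fun_prop)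

/-- Conditional on the first `n` moves, the next one is distributed according to `step`. -/
lemma lintegral_playMeasure_succ (s : S) (σ₁ σ₂ : Strat S A) (n : ℕ)
    (f : (Fin n → Move S A) × Move S A → ENNReal) :
    ∫⁻ π, f (fun k => π k, π n) ∂G.playMeasure s σ₁ σ₂ =
      ∫⁻ π, ∫⁻ m, f (fun k => π k, m) ∂(G.step σ₁ σ₂ s (prefixList n π)).toMeasure
        ∂G.playMeasure s σ₁ σ₂ := by
  have hf : Measurable f := measurable_of_countable _
  have hg : Measurable fun h : Fin n → Move S A =>
      ∫⁻ m, f (h, m) ∂(G.step σ₁ σ₂ s (List.ofFn h)).toMeasure := measurable_of_countable _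
  have hg' : Measurable fun π : ℕ → Move S A =>
      ∫⁻ m, f (fun k => π k, m) ∂(G.step σ₁ σ₂ s (prefixList n π)).toMeasure :=
    hg.comp (by fun_prop : Measurable fun (π : ℕ → Move S A) (k : Fin n) => π k)
  unfold playMeasure
  rw [Measure.lintegral_bind (by fun_prop) (by fun_prop),
    Measure.lintegral_bind (by fun_prop) hg'.aemeasurable]
  -- The first move is drawn outside the Ionescu-Tulcea kernel, so it is treated apart: the
  -- trajectory measure leaves coordinate 0 fixed at that move.
  rcases n with _ | n
  · have key : ∀ m : Move S A, ∀ g : Move S A → ENNReal,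
        ∫⁻ π, g (π 0) ∂Kernel.traj (X := fun _ => Move S A) (G.stepKernel σ₁ σ₂ s) 0
          (fun _ => m) = g m := by
      intro m g
      have h := Kernel.traj_map_frestrictLe_apply (X := fun _ => Move S A)
        (κ := G.stepKernel σ₁ σ₂ s) 0 0 (fun _ => m)
      rw [Kernel.partialTraj_self, Kernel.id_apply] at h
      have h2 : ∫⁻ x, g (x ⟨0, by simp⟩) ∂((Kernel.traj (X := fun _ => Move S A)
          (G.stepKernel σ₁ σ₂ s) 0 (fun _ => m)).map (Preorder.frestrictLe 0)) = g m := by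
        rw [h, lintegral_dirac]
      rw [lintegral_map (measurable_of_countable _) (by fun_prop)] at h2
      exact h2
    have e : ∀ π : ℕ → Move S A, (fun k : Fin 0 => π k) = Fin.elim0 := fun π =>
      Subsingleton.elim _ _
    simp only [prefixList_zero, e, lintegral_const, measure_univ, mul_one]
    refine lintegral_congr fun m => ?_
    exact key m fun m => f (Fin.elim0, m)
  · refine lintegral_congr fun m => ?_
    have h := Kernel.partialTraj_compProd_eq_map_traj (X := fun _ => Move S A)
      (κ := G.stepKernel σ₁ σ₂ s) (Nat.zero_le n) (x₀ := fun _ => m)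
    let r : (Π _ : Finset.Iic n, Move S A) → Fin (n + 1) → Move S A := fun h k =>
      h ⟨k, Finset.mem_Iic.2 (Nat.lt_succ_iff.1 k.2)⟩
    have h2 := congrArg (fun μ => ∫⁻ x, f (r x.1, x.2) ∂μ) h
    beta_reduce at h2
    rw [lintegral_map (measurable_of_countable _) (by fun_prop),
      Measure.lintegral_compProd (measurable_of_countable _),
      ← Kernel.traj_map_frestrictLe_apply,
      lintegral_map (measurable_of_countable _) (by fun_prop)] at h2
    exact h2.symm

/-- One step of the play, for bounded functions of the prefixes. -/
lemma integral_prefix_succ (s : S) (σ₁ σ₂ : Strat S A) (n : ℕ) (F : List (Move S A) → ℝ) :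
    ∫ π, F (prefixList (n + 1) π) ∂G.playMeasure s σ₁ σ₂ =
      ∫ π, ∫ m, F (prefixList n π ++ [m]) ∂(G.step σ₁ σ₂ s (prefixList n π)).toMeasure
        ∂G.playMeasure s σ₁ σ₂ := by
  let κ : Kernel (Fin n → Move S A) (Move S A) := Kernel.ofFunOfCountable fun h =>
    (G.step σ₁ σ₂ s (List.ofFn h)).toMeasure
  have : IsMarkovKernel κ := ⟨fun _ => PMF.toMeasure.isProbabilityMeasure _⟩
  let r : (ℕ → Move S A) → Fin n → Move S A := fun π k => π k
  have hr : Measurable r := by fun_prop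
  have hr2 : Measurable fun π : ℕ → Move S A => (r π, π n) := by fun_prop
  -- Nonnegative test functions identify the joint law of prefix and next move as a
  -- composition-product; this carries the one-step formula over to real-valued integrals.
  have h : (G.playMeasure s σ₁ σ₂).map (fun π => (r π, π n)) =
      ((G.playMeasure s σ₁ σ₂).map r).compProd κ := by
    have : IsProbabilityMeasure ((G.playMeasure s σ₁ σ₂).map r) :=
      Measure.isProbabilityMeasure_map hr.aemeasurable
    refine Measure.ext_of_lintegral _ fun f hf => ?_
    rw [lintegral_map hf hr2, Measure.lintegral_compProd hf,
      lintegral_map (measurable_of_countable _) hr]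
    exact G.lintegral_playMeasure_succ s σ₁ σ₂ n f
  have : IsProbabilityMeasure ((G.playMeasure s σ₁ σ₂).map r) :=
    Measure.isProbabilityMeasure_map hr.aemeasurable
  have h2 := congrArg (fun μ => ∫ x, F (List.ofFn x.1 ++ [x.2]) ∂μ) h
  beta_reduce at h2
  rw [integral_map hr2.aemeasurable (measurable_of_countable _).aestronglyMeasurable,
    Measure.integral_compProd Integrable.of_finite,
    integral_map hr.aemeasurable (measurable_of_countable _).aestronglyMeasurable] at h2
  simp only [prefixList_succ]
  exact h2

end Arena

/-! ### Expectations over finite types -/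

section expect
variable {α : Type*} {β : Type*}

/-- The move that consists of the action `a` and the state `t` reached by it. -/
def Move.of {S : Type u} {A : Type v} (a : A) (t : S) : Move S A := (a, t)

/-- Expectation of a real function under a `PMF`. -/
noncomputable def expect (p : PMF α) (f : α → ℝ) : ℝ := ∑' a, (p a).toReal * f a

lemma toReal_pos_pmf {p : PMF α} {a : α} (h : 0 < p a) : 0 < (p a).toReal :=
  ENNReal.toReal_pos h.ne' (p.apply_ne_top a)

lemma expect_eq_sum [Fintype α] (p : PMF α) (f : α → ℝ) :
    expect p f = ∑ a, (p a).toReal * f a := tsum_fintype _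

lemma sum_toReal_pmf [Fintype α] (p : PMF α) : ∑ a, (p a).toReal = 1 := by
  rw [← ENNReal.toReal_sum fun a _ => p.apply_ne_top a, ← tsum_fintype (L := .unconditional α),
    p.tsum_coe, ENNReal.toReal_one]

variable [Finite α]

@[simp] lemma expect_const (p : PMF α) (c : ℝ) : expect p (fun _ => c) = c := by
  have := Fintype.ofFinite α
  rw [expect_eq_sum, ← Finset.sum_mul, sum_toReal_pmf, one_mul]

lemma expect_mono {p : PMF α} {f g : α → ℝ} (h : ∀ a, 0 < p a → f a ≤ g a) :
    expect p f ≤ expect p g := by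
  have := Fintype.ofFinite α
  rw [expect_eq_sum, expect_eq_sum]
  refine Finset.sum_le_sum fun a _ => ?_
  rcases (zero_le (a := p a)).eq_or_lt with h0 | h0
  · simp [← h0]
  · exact mul_le_mul_of_nonneg_left (h a h0) ENNReal.toReal_nonneg

lemma expect_congr {p : PMF α} {f g : α → ℝ} (h : ∀ a, 0 < p a → f a = g a) :
    expect p f = expect p g :=
  le_antisymm (expect_mono fun a ha => (h a ha).le) (expect_mono fun a ha => (h a ha).ge)

lemma le_expect {p : PMF α} {f : α → ℝ} {c : ℝ} (h : ∀ a, 0 < p a → c ≤ f a) :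
    c ≤ expect p f := by
  simpa using expect_mono (p := p) (f := fun _ => c) h

lemma expect_le {p : PMF α} {f : α → ℝ} {c : ℝ} (h : ∀ a, 0 < p a → f a ≤ c) :
    expect p f ≤ c := by
  simpa using expect_mono (p := p) (g := fun _ => c) h

lemma expect_sub (p : PMF α) (f g : α → ℝ) :
    expect p (fun a => f a - g a) = expect p f - expect p g := by
  have := Fintype.ofFinite α
  simp only [expect_eq_sum, ← Finset.sum_sub_distrib, mul_sub]

lemma expect_const_mul (p : PMF α) (c : ℝ) (f : α → ℝ) :
    expect p (fun a => c * f a) = c * expect p f := by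
  have := Fintype.ofFinite α
  simp only [expect_eq_sum, Finset.mul_sum]
  exact Finset.sum_congr rfl fun a _ => by ring

/-- If one outcome is below the bound `c`, then so is the expectation. -/
lemma expect_le_sub {p : PMF α} {f : α → ℝ} {c d q : ℝ} (h : ∀ a, 0 < p a → f a ≤ c) {a₀ : α}
    (hq : q ≤ (p a₀).toReal) (hd : 0 ≤ d) (h0 : f a₀ ≤ c - d) : expect p f ≤ c - q * d := by
  classical
  have := Fintype.ofFinite α
  have h1 : expect p f ≤ expect p (fun a => c - if a = a₀ then d else 0) := by
    refine expect_mono fun a ha => ?_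
    split_ifs with e
    · exact e ▸ h0
    · simpa using h a ha
  have h2 : expect p (fun a => if a = a₀ then d else 0) = (p a₀).toReal * d := by
    simp [expect_eq_sum]
  rw [expect_sub, expect_const, h2] at h1
  nlinarith [mul_le_mul_of_nonneg_right hq hd]

@[simp] lemma expect_pure (a : α) (f : α → ℝ) : expect (PMF.pure a) f = f a := by
  classical
  have := Fintype.ofFinite α
  simp [expect_eq_sum, PMF.pure_apply, apply_ite ENNReal.toReal]

lemma expect_bind [Finite β] (p : PMF α) (g : α → PMF β) (f : β → ℝ) :
    expect (p.bind g) f = expect p fun a => expect (g a) f := by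
  have := Fintype.ofFinite α
  have := Fintype.ofFinite β
  simp only [expect_eq_sum, PMF.bind_apply, tsum_fintype]
  simp_rw [ENNReal.toReal_sum fun a _ => ENNReal.mul_ne_top (p.apply_ne_top a)
    ((g a).apply_ne_top _), ENNReal.toReal_mul, Finset.sum_mul, Finset.mul_sum]
  rw [Finset.sum_comm]
  exact Finset.sum_congr rfl fun a _ => Finset.sum_congr rfl fun b _ => by ring

lemma expect_map [Finite β] (p : PMF α) (g : α → β) (f : β → ℝ) :
    expect (p.map g) f = expect p fun a => f (g a) := by
  rw [PMF.map, expect_bind]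
  simp

lemma integral_toMeasure [MeasurableSpace α] [MeasurableSingletonClass α] (p : PMF α)
    (f : α → ℝ) : ∫ a, f a ∂p.toMeasure = expect p f := by
  have := Fintype.ofFinite α
  rw [PMF.integral_eq_sum, expect_eq_sum]
  rfl

end expect

/-! ### Legality of plays and a submartingale bound -/

namespace Arena

variable {S : Type u} {A : Type v} (G : Arena S A)

/-- The distribution over actions chosen by the player who controls the last state. -/
noncomputable def mover (σ₁ σ₂ : Strat S A) (s : S) (l : List (Move S A)) : PMF A :=
  match G.owner (lastState s l) with
  | Player.one => σ₁ s l
  | Player.two => σ₂ s l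

lemma integral_step [Finite S] [Finite A] (σ₁ σ₂ : Strat S A) (s : S) (l : List (Move S A))
    (f : Move S A → ℝ) :
    ∫ m, f m ∂(G.step σ₁ σ₂ s l).toMeasure = expect (G.mover σ₁ σ₂ s l) fun a =>
      expect (G.δ (lastState s l) a) fun t => f (.of a t) := by
  rw [integral_toMeasure, step, expect_bind]
  refine expect_congr fun a _ => ?_
  exact expect_map (β := A × S) _ _ f

lemma lastState_append (s : S) (l l' : List (Move S A)) :
    lastState s (l ++ l') = lastState (lastState s l) l' := by
  induction l generalizing s with
  | nil => rfl
  | cons m l ih => exact ih m.2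

lemma colHist_append (s : S) (l l' : List (Move S A)) :
    G.colHist s (l ++ l') = G.colHist s l ++ G.colHist (lastState s l) l' := by
  induction l generalizing s with
  | nil => rfl
  | cons m l ih => simp [colHist, lastState, ih]

lemma isPath_append (s : S) (l l' : List (Move S A)) :
    G.IsPath s (l ++ l') ↔ G.IsPath s l ∧ G.IsPath (lastState s l) l' := by
  induction l generalizing s with
  | nil => simp [IsPath, lastState]
  | cons m l ih => simp [IsPath, lastState, ih, and_assoc]

/-- Both strategies are legal on the histories that start in `s`. -/
lemma mover_support {σ₁ σ₂ : Strat S A} {s : S} (h₁ : G.IsStrategy {s} Player.one σ₁)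
    (h₂ : G.IsStrategy {s} Player.two σ₂) {l : List (Move S A)} (hl : G.IsPath s l) {a : A}
    (ha : 0 < G.mover σ₁ σ₂ s l a) : a ∈ G.avail (lastState s l) := by
  unfold mover at ha
  rcases ho : G.owner (lastState s l) with _ | _
  · rw [ho] at ha
    exact h₁ s l ⟨rfl, hl, ho⟩ ((PMF.mem_support_iff _ _).2 ha.ne')
  · rw [ho] at ha
    exact h₂ s l ⟨rfl, hl, ho⟩ ((PMF.mem_support_iff _ _).2 ha.ne')

variable [Finite S] [Finite A]

/-- The indicator of an illegal prefix starts at 0 and its expectation cannot increase, because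
legal strategies extend a legal prefix by illegal moves with probability 0 only. -/
lemma ae_isPath {σ₁ σ₂ : Strat S A} {s : S} (h₁ : G.IsStrategy {s} Player.one σ₁)
    (h₂ : G.IsStrategy {s} Player.two σ₂) (n : ℕ) :
    ∀ᵐ π ∂G.playMeasure s σ₁ σ₂, G.IsPath s (prefixList n π) := by
  classical
  let F : List (Move S A) → ℝ := fun l => if G.IsPath s l then 0 else 1
  have hF : ∀ l, 0 ≤ F l := fun l => by simp only [F]; split_ifs <;> norm_num
  have key : ∫ π, F (prefixList n π) ∂G.playMeasure s σ₁ σ₂ ≤ 0 := by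
    induction n with
    | zero => simp [F, IsPath]
    | succ n ih =>
      rw [integral_prefix_succ]
      refine le_trans (integral_mono ?_ (integrable_prefixFun _ n F) fun π => ?_) ih
      · exact integrable_prefixFun _ n fun l => ∫ m, F (l ++ [m]) ∂(G.step σ₁ σ₂ s l).toMeasure
      · beta_reduce
        rw [integral_step]
        refine expect_le fun a ha => expect_le fun t ht => ?_
        simp only [F]
        split_ifs with h h' h'
        · exact le_rfl
        · norm_num
        · exact absurd ((G.isPath_append _ _ [Move.of a t]).2
            ⟨h', G.mover_support h₁ h₂ h' ha, ht, trivial⟩) h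
        · exact le_rfl
  have h0 := (integral_eq_zero_iff_of_nonneg (fun π => hF _) (integrable_prefixFun _ n F)).1
    (le_antisymm key (integral_nonneg fun π => hF _))
  filter_upwards [h0] with π hπ
  by_contra hc
  simp [F, hc] at hπ

/-- A submartingale-like certificate: if `U ≤ 1` never decreases in expectation, and increases by
at least `c > 0` at the histories that are bad and have `0 < U`, then the probability of being
eventually good is at least the initial value of `U`. -/
lemma le_measureReal_of_certificate {σ₁ σ₂ : Strat S A} {s : S}
    (h₁ : G.IsStrategy {s} Player.one σ₁) (h₂ : G.IsStrategy {s} Player.two σ₂)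
    (U : List (Move S A) → ℝ) (good : List (Move S A) → Prop) {c : ℝ} (hc : 0 < c)
    (hU : ∀ l, G.IsPath s l → U l ≤ 1)
    (hstep : ∀ l, G.IsPath s l → U l ≤ expect (G.mover σ₁ σ₂ s l) fun a =>
      expect (G.δ (lastState s l) a) fun t => U (l ++ [.of a t]))
    (hbad : ∀ l, G.IsPath s l → ¬ good l → 0 < U l →
      U l + c ≤ expect (G.mover σ₁ σ₂ s l) fun a =>
        expect (G.δ (lastState s l) a) fun t => U (l ++ [.of a t]))
    {E : Set (ℕ → Move S A)} (hE : MeasurableSet E)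
    (hgood : ∀ π, ∀ᶠ n in Filter.atTop, good (prefixList n π) ↔ π ∈ E) :
    U [] ≤ (G.playMeasure s σ₁ σ₂).real E := by
  classical
  set μ := G.playMeasure s σ₁ σ₂
  let B : List (Move S A) → ℝ := fun l => if ¬ good l ∧ 0 < U l then 1 else 0
  let D : List (Move S A) → ℝ := fun l => if good l then 1 else 0
  have hB : ∀ l, 0 ≤ B l := fun l => by simp only [B]; split_ifs <;> norm_num
  have hgrow : ∀ n, ∫ π, U (prefixList n π) ∂μ + c * ∫ π, B (prefixList n π) ∂μ ≤
      ∫ π, U (prefixList (n + 1) π) ∂μ := by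
    intro n
    rw [integral_prefix_succ, ← integral_const_mul, ← integral_add (integrable_prefixFun _ n U)
      ((integrable_prefixFun _ n B).const_mul c)]
    refine integral_mono_ae ((integrable_prefixFun _ n U).add
      ((integrable_prefixFun _ n B).const_mul c)) (integrable_prefixFun _ n fun l =>
        ∫ m, U (l ++ [m]) ∂(G.step σ₁ σ₂ s l).toMeasure) ?_
    filter_upwards [G.ae_isPath h₁ h₂ n] with π hπ
    rw [integral_step]
    simp only [B]
    split_ifs with h
    · simpa using hbad _ hπ h.1 h.2
    · simpa using hstep _ hπ
  have hB0 : ∀ n, 0 ≤ ∫ π, B (prefixList n π) ∂μ := fun n => integral_nonneg fun π => hB _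
  have hU0 : ∫ π, U (prefixList 0 π) ∂μ = U [] := by simp
  have hU1 : ∀ n, ∫ π, U (prefixList n π) ∂μ ≤ 1 := by
    intro n
    have : ∫ π, U (prefixList n π) ∂μ ≤ ∫ _, (1 : ℝ) ∂μ := by
      refine integral_mono_ae (integrable_prefixFun _ n U) (integrable_const _) ?_
      filter_upwards [G.ae_isPath h₁ h₂ n] with π hπ using hU _ hπ
    simpa using this
  have hsum : ∀ n, U [] + c * ∑ k ∈ Finset.range n, ∫ π, B (prefixList k π) ∂μ ≤
      ∫ π, U (prefixList n π) ∂μ := by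
    intro n
    induction n with
    | zero => simp
    | succ n ih => rw [Finset.sum_range_succ, mul_add]; linarith [hgrow n]
  -- Each bad visit with `0 < U` adds `c` in expectation while the expectation of `U` stays below 1,
  -- so the expected number of such visits is at most `(1 - U []) / c`.
  have hsummable : Summable fun n => ∫ π, B (prefixList n π) ∂μ := by
    refine summable_of_sum_range_le hB0 (c := (1 - U []) / c) fun n => ?_
    rw [le_div_iff₀ hc]
    linarith [hsum n, hU1 n]
  -- Almost surely `U ≤ D + B` along the play: `U ≤ 1` always, and where both indicators vanish `U`
  -- is nonpositive. The term `B` then disappears in the limit.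
  have hle : ∀ n, U [] ≤ ∫ π, D (prefixList n π) ∂μ + ∫ π, B (prefixList n π) ∂μ := by
    intro n
    have h1 : U [] ≤ ∫ π, U (prefixList n π) ∂μ := by
      have := mul_nonneg hc.le (Finset.sum_nonneg fun k (_ : k ∈ Finset.range n) => hB0 k)
      linarith [hsum n]
    refine h1.trans ?_
    rw [← integral_add (integrable_prefixFun _ n D) (integrable_prefixFun _ n B)]
    refine integral_mono_ae (integrable_prefixFun _ n U)
      ((integrable_prefixFun _ n D).add (integrable_prefixFun _ n B)) ?_
    filter_upwards [G.ae_isPath h₁ h₂ n] with π hπ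
    simp only [B, D]
    by_cases hg : good (prefixList n π)
    · simpa [hg] using hU _ hπ
    · by_cases hp : 0 < U (prefixList n π)
      · simpa [hg, hp] using hU _ hπ
      · simpa [hg, hp] using not_lt.1 hp
  have hlim : Filter.Tendsto (fun n => ∫ π, D (prefixList n π) ∂μ) Filter.atTop
      (nhds (∫ π, E.indicator (fun _ => (1 : ℝ)) π ∂μ)) := by
    refine tendsto_integral_of_dominated_convergence (fun _ => 1)
      (fun n => (measurable_prefixFun n D).aestronglyMeasurable) (integrable_const _) ?_ ?_
    · intro n
      filter_upwards with π
      simp only [D]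
      split_ifs <;> simp
    · filter_upwards with π
      refine Filter.Tendsto.congr' ?_ tendsto_const_nhds
      filter_upwards [hgood π] with n hn
      simp only [D, hn, Set.indicator_apply]
  have := ge_of_tendsto' (hlim.add hsummable.tendsto_atTop_zero) hle
  rw [add_zero, integral_indicator hE] at this
  simpa [measureReal_def] using this

end Arena

/-! ### The greatest color seen so far -/

lemma foldl_max_le_iff {l : List ℕ} {m k : ℕ} :
    l.foldl max m ≤ k ↔ m ≤ k ∧ ∀ x ∈ l, x ≤ k := by
  induction l generalizing m with
  | nil => simp
  | cons a l ih => simp [ih, and_assoc]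

lemma mem_prefixList {M : Type*} {c : ℕ → M} {n : ℕ} {x : M} :
    x ∈ prefixList n c ↔ ∃ k < n, c k = x := by
  simp only [prefixList, List.mem_ofFn]
  exact ⟨fun ⟨k, hk⟩ => ⟨k, k.2, hk⟩, fun ⟨k, hk, h⟩ => ⟨⟨k, hk⟩, h⟩⟩

/-- The running maximum of a bounded sequence is eventually equal to the greatest element. -/
lemma exists_isGreatest_eventually_foldl_max {c : ℕ → ℕ} (hc : BddAbove (Set.range c)) :
    ∃ M, IsGreatest (Set.range c) M ∧
      ∀ᶠ n in Filter.atTop, (prefixList n c).foldl max 0 = M := by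
  have hM := Nat.sSup_mem (Set.range_nonempty c) hc
  have hg : IsGreatest (Set.range c) (sSup (Set.range c)) := ⟨hM, fun x hx => le_csSup hc hx⟩
  obtain ⟨k, hk⟩ := hM
  refine ⟨_, hg, ?_⟩
  filter_upwards [Filter.eventually_gt_atTop k] with n hn
  refine le_antisymm (foldl_max_le_iff.2 ⟨Nat.zero_le _, fun x hx => ?_⟩) ?_
  · obtain ⟨j, -, rfl⟩ := mem_prefixList.1 hx
    exact hg.2 ⟨j, rfl⟩
  · exact (foldl_max_le_iff.1 le_rfl).2 _ (mem_prefixList.2 ⟨k, hn, hk⟩)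

lemma mem_weakParity_iff {c : ℕ → ℕ} (hc : BddAbove (Set.range c)) :
    ∀ᶠ n in Filter.atTop, Even ((prefixList n c).foldl max 0) ↔ c ∈ weakParity := by
  obtain ⟨M, hM, h⟩ := exists_isGreatest_eventually_foldl_max hc
  filter_upwards [h] with n hn
  rw [hn]
  exact ⟨fun he => ⟨M, hM, he⟩, fun ⟨M', hM', he⟩ => hM.unique hM' ▸ he⟩

lemma prefixList_prepend (w : List ℕ) (c : ℕ → ℕ) (n : ℕ) :
    prefixList (w.length + n) (prepend w c) = w ++ prefixList n c := by
  refine List.ext_getElem (by simp [prefixList]) fun k h₁ h₂ => ?_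
  simp [prefixList, prepend, List.getElem_append]

@[simp] lemma prepend_nil : prepend [] = id := by
  ext c n
  simp [prepend]

lemma measurable_prepend (w : List ℕ) : Measurable (prepend w) := by
  refine measurable_pi_lambda _ fun n => ?_
  unfold prepend
  split_ifs <;> fun_prop

lemma measurableSet_weakParity : MeasurableSet weakParity := by
  have : weakParity = ⋃ m : {m : ℕ // Even m},
      (⋃ n, {c : ℕ → ℕ | c n = m}) ∩ ⋂ n, {c : ℕ → ℕ | c n ≤ m} := by
    ext c
    simp only [weakParity, IsGreatest, upperBounds, Set.mem_ofPred_eq, Set.mem_range,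
      Set.mem_iUnion, Set.mem_inter_iff, Set.mem_iInter, Subtype.exists, forall_exists_index,
      forall_apply_eq_imp_iff, exists_prop, and_comm]
  rw [this]
  refine MeasurableSet.iUnion fun m => (MeasurableSet.iUnion fun n => ?_).inter
    (MeasurableSet.iInter fun n => ?_)
  · exact measurableSet_eq_fun (measurable_pi_apply n) measurable_const
  · exact measurableSet_le (measurable_pi_apply n) measurable_const

/-- The colors that are good for a player when they are the greatest color of a play. -/
def goodFor : Player → ℕ → Prop
  | Player.one, m => Even m
  | Player.two, m => ¬ Even m

namespace Arena

variable {S : Type u} {A : Type v} (G : Arena S A)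

/-- The greatest color seen after the history `(s, l)`, if the past had greatest color `m`. -/
def maxHist (s : S) (m : ℕ) (l : List (Move S A)) : ℕ := (G.colHist s l).foldl max m

@[simp] lemma maxHist_nil (s : S) (m : ℕ) : G.maxHist s m [] = m := rfl

@[simp] lemma lastState_nil (s : S) : lastState s ([] : List (Move S A)) = s := rfl

@[simp] lemma lastState_concat (s : S) (l : List (Move S A)) (a : A) (t : S) :
    lastState s (l ++ [Move.of a t]) = t := by
  rw [lastState_append]; rfl

lemma maxHist_append (s : S) (m : ℕ) (l l' : List (Move S A)) :
    G.maxHist s m (l ++ l') = G.maxHist (lastState s l) (G.maxHist s m l) l' := by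
  simp [maxHist, colHist_append]

@[simp] lemma maxHist_concat (s : S) (m : ℕ) (l : List (Move S A)) (a : A) (t : S) :
    G.maxHist s m (l ++ [Move.of a t]) = max (G.maxHist s m l) (G.col (lastState s l) a) := by
  rw [maxHist_append]; rfl

lemma isPath_concat (s : S) (l : List (Move S A)) (a : A) (t : S) :
    G.IsPath s (l ++ [Move.of a t]) ↔
      G.IsPath s l ∧ a ∈ G.avail (lastState s l) ∧ 0 < G.δ (lastState s l) a t := by
  rw [isPath_append]
  simp only [IsPath, Move.of, and_true]

lemma stateAt_eq_lastState (s : S) (π : ℕ → Move S A) (n : ℕ) :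
    stateAt s π n = lastState s (prefixList n π) := by
  cases n with
  | zero => rfl
  | succ n => rw [prefixList_succ, lastState_append]; rfl

lemma colHist_prefixList (s : S) (π : ℕ → Move S A) (n : ℕ) :
    G.colHist s (prefixList n π) = prefixList n (G.colPlay s π) := by
  induction n with
  | zero => rfl
  | succ n ih =>
    rw [prefixList_succ, prefixList_succ, colHist_append, ih, ← stateAt_eq_lastState]
    rfl

lemma exists_col_le [Finite S] [Finite A] : ∃ B, ∀ s a, G.col s a ≤ B := by
  obtain ⟨B, hB⟩ := (Set.finite_range fun x : S × A => G.col x.1 x.2).bddAbove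
  exact ⟨B, fun s a => hB ⟨(s, a), rfl⟩⟩

lemma maxHist_le {B : ℕ} (hB : ∀ s a, G.col s a ≤ B) {s : S} {m : ℕ} (hm : m ≤ B)
    (l : List (Move S A)) : G.maxHist s m l ≤ B := by
  refine foldl_max_le_iff.2 ⟨hm, ?_⟩
  clear hm
  induction l generalizing s with
  | nil => simp [colHist]
  | cons a l ih =>
    intro x hx
    rcases List.mem_cons.1 hx with rfl | hx
    · exact hB _ _
    · exact ih x hx

/-- The plays from `s` won by player `i`, if the past had greatest color `m`. -/
def winEvent (i : Player) (s : S) (m : ℕ) : Set (ℕ → Move S A) :=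
  {π | ∀ᶠ n in Filter.atTop, goodFor i (G.maxHist s m (prefixList n π))}

variable [Finite S] [Finite A]

lemma measurable_colPlay (s : S) : Measurable (G.colPlay s) := by
  refine measurable_pi_lambda _ fun n => ?_
  rcases n with _ | n
  · exact (measurable_of_countable fun m : Move S A => G.col s m.1).comp (measurable_pi_apply 0)
  · have h : Measurable fun π : ℕ → Move S A => (π n, π (n + 1)) := by fun_prop
    exact (measurable_of_countable fun m : Move S A × Move S A => G.col m.1.2 m.2.1).comp h

/-- The past acts only through its maximum, which is the starting value of the running maximum;
finiteness of the arena bounds the colors, so that maximum stabilizes. -/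
lemma eventually_even_iff (s : S) (w : List ℕ) (π : ℕ → Move S A) :
    ∀ᶠ n in Filter.atTop, Even (G.maxHist s (w.foldl max 0) (prefixList n π)) ↔
      prepend w (G.colPlay s π) ∈ weakParity := by
  obtain ⟨B, hB⟩ := G.exists_col_le
  have hb : BddAbove (Set.range (prepend w (G.colPlay s π))) := by
    refine ⟨max B (w.foldl max 0), ?_⟩
    rintro _ ⟨n, rfl⟩
    unfold prepend
    split_ifs with h
    · exact le_max_of_le_right ((foldl_max_le_iff.1 le_rfl).2 _ (List.getElem_mem h))
    · exact le_max_of_le_left (hB _ _)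
  have h := (Filter.tendsto_add_atTop_nat w.length).eventually (mem_weakParity_iff hb)
  filter_upwards [h] with n hn
  rw [add_comm, prefixList_prepend, List.foldl_append, ← colHist_prefixList] at hn
  exact hn

lemma eventually_goodFor_iff (i : Player) (s : S) (w : List ℕ) (π : ℕ → Move S A) :
    ∀ᶠ n in Filter.atTop, goodFor i (G.maxHist s (w.foldl max 0) (prefixList n π)) ↔
      π ∈ G.winEvent i s (w.foldl max 0) := by
  have h := G.eventually_even_iff s w π
  -- Since the parity stabilizes, "eventually good" is the exact negation of "eventually bad" rather
  -- than of "bad infinitely often".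
  have key : ∀ P : ℕ → Prop, ∀ Q : Prop, (∀ᶠ n in Filter.atTop, P n ↔ Q) →
      ∀ᶠ n in Filter.atTop, P n ↔ ∀ᶠ n in Filter.atTop, P n := by
    intro P Q hPQ
    have : (∀ᶠ n in Filter.atTop, P n) ↔ Q := by
      rw [Filter.eventually_congr hPQ, Filter.eventually_const]
    rw [this]
    exact hPQ
  cases i with
  | one => exact key _ _ h
  | two => exact key _ (¬ _) (h.mono fun n hn => not_congr hn)

lemma winEvent_one (s : S) (w : List ℕ) : G.winEvent Player.one s (w.foldl max 0) =
    G.colPlay s ⁻¹' (prepend w ⁻¹' weakParity) := by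
  ext π
  have : (∀ᶠ n in Filter.atTop,
      goodFor Player.one (G.maxHist s (w.foldl max 0) (prefixList n π))) ↔ _ :=
    Filter.eventually_congr (G.eventually_even_iff s w π)
  rw [Filter.eventually_const] at this
  exact this

lemma winEvent_two (s : S) (w : List ℕ) : G.winEvent Player.two s (w.foldl max 0) =
    (G.winEvent Player.one s (w.foldl max 0))ᶜ := by
  ext π
  rw [winEvent_one]
  have : (∀ᶠ n in Filter.atTop,
      goodFor Player.two (G.maxHist s (w.foldl max 0) (prefixList n π))) ↔ _ :=
    Filter.eventually_congr ((G.eventually_even_iff s w π).mono fun n hn => not_congr hn)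
  rw [Filter.eventually_const] at this
  exact this

lemma measurableSet_winEvent (i : Player) (s : S) (w : List ℕ) :
    MeasurableSet (G.winEvent i s (w.foldl max 0)) := by
  have h1 : MeasurableSet (G.winEvent Player.one s (w.foldl max 0)) := by
    rw [winEvent_one]
    exact G.measurable_colPlay s (measurable_prepend w measurableSet_weakParity)
  cases i with
  | one => exact h1
  | two => rw [winEvent_two]; exact h1.compl

lemma outcome_map_prepend (s : S) (σ₁ σ₂ : Strat S A) (w : List ℕ) :
    (G.outcome s σ₁ σ₂).map (prepend w) weakParity =
      G.playMeasure s σ₁ σ₂ (G.winEvent Player.one s (w.foldl max 0)) := by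
  rw [winEvent_one, outcome, Measure.map_apply (measurable_prepend w) measurableSet_weakParity,
    Measure.map_apply (G.measurable_colPlay s) (measurable_prepend w measurableSet_weakParity)]

end Arena

/-! ### Certificates guarantee winning probabilities -/

/-- Finitely many positive reals have a positive lower bound. -/
lemma exists_pos_lower_bound {ι : Type*} [Finite ι] (f : ι → ℝ) :
    ∃ ε, 0 < ε ∧ ∀ i, 0 < f i → ε ≤ f i := by
  classical
  have := Fintype.ofFinite ι
  obtain ⟨ε, h0, h⟩ : ∃ ε, 0 < ε ∧ ∀ i ∈ (Finset.univ : Finset ι), 0 < f i → ε ≤ f i := by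
    induction (Finset.univ : Finset ι) using Finset.induction_on with
    | empty => exact ⟨1, one_pos, by simp⟩
    | insert i s _ ih =>
      obtain ⟨ε, h0, h⟩ := ih
      by_cases hi : 0 < f i
      · refine ⟨min ε (f i), lt_min h0 hi, fun j hj hpos => ?_⟩
        rcases Finset.mem_insert.1 hj with rfl | hj
        · exact min_le_right _ _
        · exact (min_le_left _ _).trans (h j hj hpos)
      · refine ⟨ε, h0, fun j hj hpos => ?_⟩
        rcases Finset.mem_insert.1 hj with rfl | hj
        · exact absurd hpos hi
        · exact h j hj hpos
  exact ⟨ε, h0, fun i => h i (Finset.mem_univ i)⟩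

lemma eq_zero_of_expect_le_zero {α : Type*} [Finite α] {p : PMF α} {f : α → ℝ}
    (hf : ∀ a, 0 ≤ f a) (h : expect p f ≤ 0) {a : α} (ha : 0 < p a) : f a = 0 := by
  have := Fintype.ofFinite α
  rw [expect_eq_sum] at h
  have hn : ∀ a ∈ Finset.univ, 0 ≤ (p a).toReal * f a := fun a _ =>
    mul_nonneg ENNReal.toReal_nonneg (hf a)
  have := (Finset.sum_eq_zero_iff_of_nonneg hn).1 (le_antisymm h (Finset.sum_nonneg hn)) a
    (Finset.mem_univ a)
  exact (mul_eq_zero.1 this).resolve_left (toReal_pos_pmf ha).ne'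

namespace Arena

variable {S : Type u} {A : Type v} (G : Arena S A)

/-- The expected value of `w`, a function of the greatest color seen and of the current state,
after playing `a` in `s`, if the greatest color seen was `m`. -/
noncomputable def after (w : ℕ → S → ℝ) (m : ℕ) (s : S) (a : A) : ℝ :=
  expect (G.δ s a) fun t => w (max m (G.col s a)) t

/-- Playing `a` in `s` may increase the greatest color seen `m`, or decrease the rank. -/
def Progress (r : ℕ → S → ℕ) (m : ℕ) (s : S) (a : A) : Prop :=
  ∃ t, 0 < G.δ s a t ∧ (m < G.col s a ∨ r m t < r m s)

/-- A certificate that player `i` ensures to win with probability at least `w` by playing `nxt`. -/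
structure IsCertificate (i : Player) (w : ℕ → S → ℝ) (r : ℕ → S → ℕ) (nxt : ℕ → S → A) :
    Prop where
  nonneg : ∀ m s, 0 ≤ w m s
  le_one : ∀ m s, w m s ≤ 1
  avail : ∀ m s, nxt m s ∈ G.avail s
  le_after : ∀ m s, ∀ a ∈ G.avail s, (G.owner s = i → a = nxt m s) → w m s ≤ G.after w m s a
  progress : ∀ m s, ∀ a ∈ G.avail s, (G.owner s = i → a = nxt m s) →
    G.after w m s a = w m s → ¬ goodFor i m → 0 < w m s → G.Progress r m s a

/-- The strategy `σ` of player `i` plays `nxt` from `s`, if the past had greatest color `m`. -/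
def Follows (i : Player) (s : S) (m : ℕ) (nxt : ℕ → S → A) (σ : Strat S A) : Prop :=
  ∀ l, G.IsPath s l → G.owner (lastState s l) = i →
    σ s l = PMF.pure (nxt (G.maxHist s m l) (lastState s l))

/-- The strategy of player `i` in a pair of strategies. -/
def ofPlayer {S : Type u} {A : Type v} (σ₁ σ₂ : Strat S A) : Player → Strat S A
  | Player.one => σ₁
  | Player.two => σ₂

lemma mover_eq {σ₁ σ₂ : Strat S A} {s : S} {l : List (Move S A)} {i : Player}
    (h : G.owner (lastState s l) = i) : G.mover σ₁ σ₂ s l = ofPlayer σ₁ σ₂ i s l := by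
  unfold mover
  cases i <;> rw [h] <;> rfl

variable [Finite S] [Finite A]

/-- From a certificate, a bounded potential that decreases by a fixed amount in expectation. -/
lemma IsCertificate.exists_potential {i : Player} {w : ℕ → S → ℝ} {r : ℕ → S → ℕ}
    {nxt : ℕ → S → A} (h : G.IsCertificate i w r nxt) {N : ℕ} (hN : ∀ s a, G.col s a ≤ N) :
    ∃ g : ℕ → S → ℝ, ∃ c, 0 < c ∧ c ≤ 1 ∧ (∀ m s, 0 ≤ g m s) ∧ (∀ m s, g m s ≤ 2 * N + 1) ∧
      ∀ m ≤ N, ∀ s, ∀ a ∈ G.avail s, (G.owner s = i → a = nxt m s) → G.after w m s a = w m s →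
        G.after g m s a ≤ g m s ∧ (¬ goodFor i m → 0 < w m s → G.after g m s a + c ≤ g m s) := by
  classical
  obtain ⟨p, hp0, hp⟩ := exists_pos_lower_bound
    fun x : S × A × S => (G.δ x.1 x.2.1 x.2.2).toReal
  obtain ⟨R, hR⟩ := (Set.finite_range fun x : Fin (N + 1) × S => r x.1 x.2).bddAbove
  have hR : ∀ m ≤ N, ∀ s, r m s ≤ R := fun m hm s => hR ⟨(⟨m, by omega⟩, s), rfl⟩
  -- With `p` a lower bound on the positive transition probabilities, `2 * q ≤ p` makes a chance `p`
  -- of gaining `q ^ r` worth at least twice `q ^ (r + 1)`: one half pays for the worst case of the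
  -- other successors, the other half is the net decrease.
  let q := min (p / 2) 1
  have hq0 : 0 < q := by positivity
  have hq1 : q ≤ 1 := min_le_right _ _
  have hpq : 2 * q ≤ p := by linarith [min_le_left (p / 2) 1]
  have hpow : ∀ k, 0 < q ^ k ∧ q ^ k ≤ 1 := fun k => ⟨pow_pos hq0 k, pow_le_one₀ hq0.le hq1⟩
  let e : ℕ → S → ℝ := fun m s => if ¬ goodFor i m ∧ 0 < w m s then 1 - q ^ (r m s + 1) else 0
  have he0 : ∀ m s, 0 ≤ e m s := fun m s => by
    simp only [e]; split_ifs
    · linarith [(hpow (r m s + 1)).2]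
    · exact le_rfl
  have he1 : ∀ m s, e m s ≤ 1 := fun m s => by
    simp only [e]; split_ifs
    · linarith [(hpow (r m s + 1)).1]
    · exact zero_le_one
  have hup : ∀ m m', m < m' → m' ≤ N → 2 * ((N - m' : ℕ) : ℝ) + 2 ≤ 2 * ((N - m : ℕ) : ℝ) := by
    intro m m' h1 h2
    have : (N - m') + 1 ≤ N - m := by omega
    have : ((N - m' : ℕ) : ℝ) + 1 ≤ ((N - m : ℕ) : ℝ) := by exact_mod_cast this
    linarith
  -- Raising the level lowers the first summand by at least 2, which outweighs any change of `e`,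
  -- whose values lie in `[0, 1]`. At a fixed level `e` grows with the rank, and the largest rank
  -- `R` up to level `N` gives the uniform decrease `q ^ (R + 1)`.
  refine ⟨fun m s => 2 * ((N - m : ℕ) : ℝ) + e m s, q ^ (R + 1), (hpow _).1, (hpow _).2,
    fun m s => by have := he0 m s; positivity, fun m s => ?_, ?_⟩
  · have : ((N - m : ℕ) : ℝ) ≤ N := by exact_mod_cast Nat.sub_le N m
    linarith [he1 m s]
  intro m hm s a ha hnxt heq
  have hcol : max m (G.col s a) ≤ N := max_le hm (hN s a)
  have hbase : ∀ t, 2 * ((N - max m (G.col s a) : ℕ) : ℝ) + e (max m (G.col s a)) t ≤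
      2 * ((N - m : ℕ) : ℝ) + 1 := fun t => by
    have : ((N - max m (G.col s a) : ℕ) : ℝ) ≤ ((N - m : ℕ) : ℝ) := by
      exact_mod_cast Nat.sub_le_sub_left (le_max_left _ _) N
    linarith [he1 (max m (G.col s a)) t]
  have hprog : ¬ goodFor i m → 0 < w m s →
      G.after (fun m s => 2 * ((N - m : ℕ) : ℝ) + e m s) m s a + q ^ (R + 1) ≤
        2 * ((N - m : ℕ) : ℝ) + e m s := by
    intro hg hw
    obtain ⟨t, ht, hprog⟩ := h.progress m s a ha hnxt heq hg hw
    have hpt : p ≤ (G.δ s a t).toReal := hp (s, a, t) (toReal_pos_pmf ht)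
    have h1 : G.after (fun m s => 2 * ((N - m : ℕ) : ℝ) + e m s) m s a ≤
        2 * ((N - m : ℕ) : ℝ) + 1 - p * q ^ r m s := by
      refine expect_le_sub (fun t _ => hbase t) hpt (hpow _).1.le ?_
      by_cases hcol' : m < G.col s a
      · rw [max_eq_right hcol'.le]
        linarith [hup m _ hcol' (hN s a), he1 (G.col s a) t, (hpow (r m s)).2]
      · rw [max_eq_left (not_lt.1 hcol')]
        have hr := hprog.resolve_left hcol'
        have : e m t ≤ 1 - q ^ r m s := by
          simp only [e]
          split_ifs
          · linarith [pow_le_pow_of_le_one hq0.le hq1 (show r m t + 1 ≤ r m s from hr)]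
          · linarith [(hpow (r m s)).2]
        linarith
    have h2 : e m s = 1 - q ^ (r m s + 1) := if_pos ⟨hg, hw⟩
    have h3 : 2 * q ^ (r m s + 1) ≤ p * q ^ r m s := by
      rw [pow_succ]
      nlinarith [(hpow (r m s)).1]
    have h4 : q ^ (R + 1) ≤ q ^ (r m s + 1) :=
      pow_le_pow_of_le_one hq0.le hq1 (Nat.succ_le_succ (hR m hm s))
    linarith
  refine ⟨?_, hprog⟩
  by_cases hc : ¬ goodFor i m ∧ 0 < w m s
  · linarith [hprog hc.1 hc.2, (hpow (R + 1)).1]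
  refine expect_le fun t ht => ?_
  have h2 : e m s = 0 := if_neg hc
  beta_reduce
  rw [h2, add_zero]
  by_cases hcol' : m < G.col s a
  · rw [max_eq_right hcol'.le]
    linarith [hup m _ hcol' (hN s a), he1 (G.col s a) t]
  · have hmax : max m (G.col s a) = m := max_eq_left (not_lt.1 hcol')
    rw [hmax]
    have : e m t = 0 := by
      -- At a bad level `e m s = 0` means that `w m s = 0`; as the action preserves `w`, the
      -- nonnegative `w` vanishes at all possible successors, so `e` stays 0.
      refine if_neg fun hct => ?_
      have hw0 : w m s ≤ 0 := not_lt.1 fun hw => hc ⟨hct.1, hw⟩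
      rw [← heq] at hw0
      have := eq_zero_of_expect_le_zero (fun t => h.nonneg _ t) hw0 ht
      rw [hmax] at this
      exact hct.2.ne' this
    linarith

/-- A player who plays according to a certificate wins at least with the certified probability. -/
theorem IsCertificate.le_measureReal_winEvent {i : Player} {w : ℕ → S → ℝ} {r : ℕ → S → ℕ}
    {nxt : ℕ → S → A} (h : G.IsCertificate i w r nxt) {σ₁ σ₂ : Strat S A} {s : S} {u : List ℕ}
    (h₁ : G.IsStrategy {s} Player.one σ₁) (h₂ : G.IsStrategy {s} Player.two σ₂)
    (hσ : G.Follows i s (u.foldl max 0) nxt (ofPlayer σ₁ σ₂ i)) :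
    w (u.foldl max 0) s ≤
      (G.playMeasure s σ₁ σ₂).real (G.winEvent i s (u.foldl max 0)) := by
  classical
  set m₀ := u.foldl max 0 with hm₀
  obtain ⟨B, hB⟩ := G.exists_col_le
  set N := max m₀ B
  have hN : ∀ s a, G.col s a ≤ N := fun s a => (hB s a).trans (le_max_right _ _)
  obtain ⟨g, c, hc0, hc1, hg0, hg1, hg⟩ := h.exists_potential G hN
  -- Finitely many levels, states and actions are relevant, so an action that strictly improves `w`
  -- improves it by at least a uniform `η`.
  obtain ⟨η, hη0, hη⟩ := exists_pos_lower_bound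
    fun x : Fin (N + 1) × S × A => G.after w x.1 x.2.1 x.2.2 - w x.1 x.2.1
  have hη : ∀ m ≤ N, ∀ s a, w m s < G.after w m s a → w m s + η ≤ G.after w m s a := by
    intro m hm s a hlt
    have := hη (⟨m, by omega⟩, s, a) (sub_pos.2 hlt)
    simp only at this
    linarith
  have main : ∀ ε, 0 < ε → ε * (2 * N + 2) ≤ η → w m₀ s - ε * (2 * N + 1) ≤
      (G.playMeasure s σ₁ σ₂).real (G.winEvent i s m₀) := by
    intro ε hε hεη
    let U : List (Move S A) → ℝ := fun l =>
      w (G.maxHist s m₀ l) (lastState s l) - ε * g (G.maxHist s m₀ l) (lastState s l)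
    have hlocal : ∀ l, G.IsPath s l → ∀ a, 0 < G.mover σ₁ σ₂ s l a →
        U l + (if ¬ goodFor i (G.maxHist s m₀ l) ∧ 0 < U l then ε * c else 0) ≤
        expect (G.δ (lastState s l) a) fun t => U (l ++ [Move.of a t]) := by
      intro l hl a ha
      have hav := G.mover_support h₁ h₂ hl ha
      simp only [U, lastState_concat, maxHist_concat, expect_sub, expect_const_mul]
      set m := G.maxHist s m₀ l
      set t := lastState s l
      have hm : m ≤ N := G.maxHist_le hN (le_max_left _ _) l
      change _ ≤ G.after w m t a - ε * G.after g m t a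
      have hnxt : G.owner t = i → a = nxt m t := by
        intro ho
        rw [G.mover_eq ho, hσ l hl ho] at ha
        exact (PMF.mem_support_pure_iff _ _).1 ((PMF.mem_support_iff _ _).2 ha.ne')
      -- If `w` is preserved, the drop of `g` supplies the growth of `U`. If `w` strictly increases,
      -- the gain `η` covers the largest possible loss `ε * (2 * N + 1)` and leaves `ε`, which is at
      -- least `ε * c`.
      rcases (h.le_after m t a hav hnxt).eq_or_lt with heq | hlt
      · obtain ⟨h5, h6⟩ := hg m hm t a hav hnxt heq.symm
        split_ifs with hcond
        · have hw : 0 < w m t := by nlinarith [hcond.2, mul_nonneg hε.le (hg0 m t)]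
          nlinarith [h6 hcond.1 hw]
        · nlinarith
      · have h5 := hη m hm t a hlt
        have h6 : G.after g m t a ≤ 2 * N + 1 := expect_le fun t _ => hg1 _ t
        have h7 : (if ¬ goodFor i m ∧ 0 < w m t - ε * g m t then ε * c else 0) ≤ ε := by
          split_ifs
          · nlinarith
          · exact hε.le
        nlinarith [mul_nonneg hε.le (hg0 m t), mul_le_mul_of_nonneg_left h6 hε.le]
    have hU0 : w m₀ s - ε * (2 * N + 1) ≤ U [] := by
      simp only [U, maxHist_nil, lastState_nil]
      nlinarith [hg1 m₀ s]
    refine hU0.trans (G.le_measureReal_of_certificate h₁ h₂ U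
      (fun l => goodFor i (G.maxHist s m₀ l)) (mul_pos hε hc0) (fun l _ => ?_) (fun l hl => ?_)
      (fun l hl hgood hpos => ?_) (G.measurableSet_winEvent i s u)
      (G.eventually_goodFor_iff i s u))
    · simp only [U]
      nlinarith [h.le_one (G.maxHist s m₀ l) (lastState s l),
        mul_nonneg hε.le (hg0 (G.maxHist s m₀ l) (lastState s l))]
    · refine le_expect fun a ha => le_trans ?_ (hlocal l hl a ha)
      split_ifs
      · linarith [mul_pos hε hc0]
      · linarith
    · refine le_expect fun a ha => le_trans ?_ (hlocal l hl a ha)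
      rw [if_pos ⟨hgood, hpos⟩]
  refine le_of_forall_pos_le_add fun ε hε => ?_
  have hpos : (0 : ℝ) < 2 * N + 2 := by positivity
  have h1 := main (min ε η / (2 * N + 2)) (by positivity)
    (by rw [div_mul_cancel₀ _ hpos.ne']; exact min_le_right _ _)
  have h2 : min ε η / (2 * N + 2) * (2 * N + 1) ≤ ε := by
    rw [div_mul_eq_mul_div, div_le_iff₀ hpos]
    nlinarith [min_le_left ε η]
  linarith

end Arena

/-! ### The optimality equation and the construction of the value -/

namespace Arena

variable {S : Type u} {A : Type v} (G : Arena S A)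

/-- The optimality equation at the level `m`, for a value `w` that player `i` maximizes. -/
def IsBellman (i : Player) (w : ℕ → S → ℝ) (m : ℕ) : Prop :=
  ∀ s, (∃ a ∈ G.avail s, G.after w m s a = w m s) ∧
    (G.owner s = i → ∀ a ∈ G.avail s, G.after w m s a ≤ w m s) ∧
    (G.owner s ≠ i → ∀ a ∈ G.avail s, w m s ≤ G.after w m s a)

/-- Among the functions that extend `w` above the level `m`, there is no smaller subsolution of the
optimality equation at the level `m`. -/
def IsLeastSolution (i : Player) (w : ℕ → S → ℝ) (m : ℕ) : Prop :=
  ∀ f : S → ℝ, (∀ s, 0 ≤ f s) → (∀ s, f s ≤ w m s) →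
    (∀ s, (G.owner s = i → ∀ a ∈ G.avail s, G.after (Function.update w m f) m s a ≤ f s) ∧
      (G.owner s ≠ i → ∃ a ∈ G.avail s, G.after (Function.update w m f) m s a ≤ f s)) →
    f = w m

/-- The value for player `i` of a game in which player one has value `v`. -/
def sideValue (v : ℕ → S → ℝ) : Player → ℕ → S → ℝ
  | Player.one => v
  | Player.two => fun m s => 1 - v m s

lemma sideValue_sideValue (v : ℕ → S → ℝ) (i : Player) :
    sideValue (sideValue v i) i = v := by
  cases i with
  | one => rfl
  | two => funext m s; simp [sideValue]

lemma sideValue_congr {v v' : ℕ → S → ℝ} {m : ℕ} (h : v m = v' m) (i : Player) :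
    sideValue v i m = sideValue v' i m := by
  cases i <;> simp [sideValue, h]

lemma sideValue_mem {v : ℕ → S → ℝ} (h0 : ∀ m s, 0 ≤ v m s) (h1 : ∀ m s, v m s ≤ 1) (i : Player)
    (m : ℕ) (s : S) : 0 ≤ sideValue v i m s ∧ sideValue v i m s ≤ 1 := by
  have := h0 m s
  have := h1 m s
  cases i <;> simp only [sideValue] <;> constructor <;> linarith

lemma goodFor_unique {i j : Player} {m : ℕ} (hi : ¬ goodFor i m) (hj : ¬ goodFor j m) : i = j := by
  cases i <;> cases j <;> simp_all [goodFor]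

lemma exists_not_goodFor (m : ℕ) : ∃ i, ¬ goodFor i m := by
  by_cases h : Even m
  · exact ⟨Player.two, by simpa [goodFor] using h⟩
  · exact ⟨Player.one, h⟩

/-- The value when no color exceeds the greatest color seen. -/
noncomputable def terminalValue (m : ℕ) (_ : S) : ℝ := open Classical in if Even m then 1 else 0

lemma sideValue_terminalValue {i : Player} {m : ℕ} (hi : ¬ goodFor i m) (s : S) :
    sideValue terminalValue i m s = 0 := by
  cases i <;> simp_all [sideValue, terminalValue, goodFor]

section after
variable [Finite S]

lemma after_mono {w w' : ℕ → S → ℝ} {m : ℕ} (h : ∀ m' ≥ m, ∀ t, w m' t ≤ w' m' t) (s : S) (a : A) :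
    G.after w m s a ≤ G.after w' m s a :=
  expect_mono fun t _ => h _ (le_max_left _ _) t

/-- The greatest color never decreases, so one step from level `m` sees only levels `≥ m`. Changing
lower levels thus preserves what is already solved, which makes the downward construction possible.
-/
lemma after_congr {w w' : ℕ → S → ℝ} {m : ℕ} (h : ∀ m' ≥ m, w m' = w' m') (s : S) (a : A) :
    G.after w m s a = G.after w' m s a :=
  expect_congr fun t _ => congrFun (h _ (le_max_left _ _)) t

lemma after_one_sub (w : ℕ → S → ℝ) (m : ℕ) (s : S) (a : A) :
    G.after (fun m s => 1 - w m s) m s a = 1 - G.after w m s a := by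
  rw [after, expect_sub, expect_const, after]

lemma IsBellman.congr {i : Player} {w w' : ℕ → S → ℝ} {m : ℕ} (h : ∀ m' ≥ m, w m' = w' m')
    (hw : G.IsBellman i w m) : G.IsBellman i w' m := by
  intro s
  simp only [← h m le_rfl, ← G.after_congr h]
  exact hw s

lemma IsLeastSolution.congr {i : Player} {w w' : ℕ → S → ℝ} {m : ℕ}
    (h : ∀ m' ≥ m, w m' = w' m') (hw : G.IsLeastSolution i w m) : G.IsLeastSolution i w' m := by
  intro f hf0 hf1 hf
  have h' : ∀ m' ≥ m, Function.update w m f m' = Function.update w' m f m' := by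
    intro m' hm'
    rcases eq_or_ne m' m with rfl | hne
    · simp
    · simp [hne, h m' hm']
  rw [← h m le_rfl] at hf1 ⊢
  simp only [← G.after_congr h'] at hf
  exact hw f hf0 hf1 hf

lemma IsBellman.one_sub {i j : Player} (hij : i ≠ j) {w : ℕ → S → ℝ} {m : ℕ}
    (hw : G.IsBellman i w m) : G.IsBellman j (fun m s => 1 - w m s) m := by
  have hown : ∀ s, G.owner s = j ↔ G.owner s ≠ i := by
    intro s
    generalize G.owner s = k
    cases i <;> cases j <;> cases k <;> simp_all
  intro s
  simp only [after_one_sub, sub_right_inj, sub_le_sub_iff_left]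
  refine ⟨(hw s).1, fun h => (hw s).2.2 ((hown s).1 h), fun h => (hw s).2.1 ?_⟩
  by_contra hc
  exact h ((hown s).2 hc)

/-- The properties that characterize the value at level `m`, given the values above. -/
structure IsValueAt (v : ℕ → S → ℝ) (m : ℕ) : Prop where
  bellman : ∀ i, G.IsBellman i (sideValue v i) m
  least : ∀ i, ¬ goodFor i m → G.IsLeastSolution i (sideValue v i) m

lemma IsValueAt.congr {v v' : ℕ → S → ℝ} {m : ℕ} (h : ∀ m' ≥ m, v m' = v' m')
    (hv : G.IsValueAt v m) : G.IsValueAt v' m :=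
  ⟨fun i => (hv.bellman i).congr G fun m' hm' => sideValue_congr (h m' hm') i,
    fun i hi => (hv.least i hi).congr G fun m' hm' => sideValue_congr (h m' hm') i⟩

/-- The optimality equation is self-dual under `w ↦ 1 - w` with the players exchanged, and `m` is
bad for one player only, so checking that player suffices. -/
lemma IsValueAt.of_side {v : ℕ → S → ℝ} {m : ℕ} {i : Player} (hi : ¬ goodFor i m)
    (h : G.IsBellman i (sideValue v i) m) (h' : G.IsLeastSolution i (sideValue v i) m) :
    G.IsValueAt v m := by
  refine ⟨fun j => ?_, fun j hj => goodFor_unique hi hj ▸ h'⟩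
  by_cases hij : i = j
  · exact hij ▸ h
  · have := h.one_sub G hij
    convert this using 1
    funext m s
    cases i <;> cases j <;> simp_all [sideValue]

/-- The level can no longer change, so the player for whom `m` is bad has value identically 0, and
leastness is immediate. -/
lemma isValueAt_terminalValue {m : ℕ} (hm : ∀ s a, G.col s a ≤ m) :
    G.IsValueAt terminalValue m := by
  obtain ⟨i, hi⟩ := exists_not_goodFor m
  have h0 := sideValue_terminalValue (S := S) hi
  refine IsValueAt.of_side G hi (fun s => ?_) fun f hf0 hf1 _ => ?_
  · have : ∀ a, G.after (sideValue terminalValue i) m s a = 0 := by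
      intro a
      simp only [after, max_eq_left (hm s a), h0, expect_const]
    obtain ⟨a, ha⟩ := G.avail_nonempty s
    exact ⟨⟨a, ha, by rw [this, h0]⟩, fun _ a _ => by rw [this, h0], fun _ a _ => by rw [this, h0]⟩
  · exact funext fun s => le_antisymm (hf1 s) (by rw [h0]; exact hf0 s)

end after

variable [Finite A]

/-- The optimum over the actions available in `s`, for a value `g` that player `i` maximizes. -/
noncomputable def optimum (i : Player) (s : S) (g : A → ℝ) : ℝ :=
  open Classical in if G.owner s = i then sSup (g '' G.avail s) else sInf (g '' G.avail s)

lemma optimum_of_owner_eq {i : Player} {s : S} (h : G.owner s = i) (g : A → ℝ) :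
    IsGreatest (g '' G.avail s) (G.optimum i s g) := by
  have hf : (g '' G.avail s).Finite := Set.toFinite _
  rw [optimum, if_pos h]
  exact ⟨((G.avail_nonempty s).image g).csSup_mem hf, fun x hx => le_csSup hf.bddAbove hx⟩

lemma optimum_of_owner_ne {i : Player} {s : S} (h : G.owner s ≠ i) (g : A → ℝ) :
    IsLeast (g '' G.avail s) (G.optimum i s g) := by
  have hf : (g '' G.avail s).Finite := Set.toFinite _
  rw [optimum, if_neg h]
  exact ⟨((G.avail_nonempty s).image g).csInf_mem hf, fun x hx => csInf_le hf.bddBelow hx⟩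

lemma exists_optimum_eq (i : Player) (s : S) (g : A → ℝ) :
    ∃ a ∈ G.avail s, g a = G.optimum i s g := by
  by_cases h : G.owner s = i
  · exact (G.optimum_of_owner_eq h g).1
  · exact (G.optimum_of_owner_ne h g).1

lemma optimum_mono (i : Player) (s : S) {g g' : A → ℝ} (hg : ∀ a, g a ≤ g' a) :
    G.optimum i s g ≤ G.optimum i s g' := by
  by_cases h : G.owner s = i
  · obtain ⟨a, ha, hga⟩ := (G.optimum_of_owner_eq h g).1
    exact hga ▸ (hg a).trans ((G.optimum_of_owner_eq h g').2 ⟨a, ha, rfl⟩)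
  · obtain ⟨a, ha, hga⟩ := (G.optimum_of_owner_ne h g').1
    exact hga ▸ ((G.optimum_of_owner_ne h g).2 ⟨a, ha, rfl⟩).trans (hg a)

variable [Finite S]

/-- Knaster-Tarski on the complete lattice of functions `S → [0, 1]`: the one-step optimum is
monotone, its least fixed point solves the equation, and the least fixed point lies below every
subsolution. -/
lemma exists_solution (i : Player) (w : ℕ → S → ℝ) (m : ℕ) (h0 : ∀ m s, 0 ≤ w m s)
    (h1 : ∀ m s, w m s ≤ 1) :
    ∃ f : S → ℝ, (∀ s, 0 ≤ f s) ∧ (∀ s, f s ≤ 1) ∧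
      G.IsBellman i (Function.update w m f) m ∧
      G.IsLeastSolution i (Function.update w m f) m := by
  have : Fact ((0 : ℝ) ≤ 1) := ⟨zero_le_one⟩
  have hup : ∀ f : S → ℝ, (∀ s, 0 ≤ f s) → (∀ s, f s ≤ 1) →
      ∀ k s, 0 ≤ Function.update w m f k s ∧ Function.update w m f k s ≤ 1 := by
    intro f hf0 hf1 k s
    rcases eq_or_ne k m with rfl | hk
    · simpa using ⟨hf0 s, hf1 s⟩
    · simpa [hk] using ⟨h0 k s, h1 k s⟩
  have hopt : ∀ f : S → ℝ, (∀ s, 0 ≤ f s) → (∀ s, f s ≤ 1) → ∀ s,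
      G.optimum i s (G.after (Function.update w m f) m s) ∈ Set.Icc (0 : ℝ) 1 := by
    intro f hf0 hf1 s
    obtain ⟨a, -, ha⟩ := G.exists_optimum_eq i s (G.after (Function.update w m f) m s)
    rw [← ha]
    exact ⟨le_expect fun t _ => (hup f hf0 hf1 _ t).1, expect_le fun t _ => (hup f hf0 hf1 _ t).2⟩
  let T : (S → Set.Icc (0 : ℝ) 1) →o (S → Set.Icc (0 : ℝ) 1) :=
    { toFun := fun f s => ⟨G.optimum i s (G.after (Function.update w m fun t => f t) m s),
        hopt _ (fun s => (f s).2.1) (fun s => (f s).2.2) s⟩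
      monotone' := fun f f' hf s => by
        refine G.optimum_mono i s fun a => G.after_mono (fun k _ t => ?_) s a
        rcases eq_or_ne k m with rfl | hk
        · simpa using hf t
        · simp [hk] }
  have hfix : ∀ s, G.optimum i s (G.after (Function.update w m fun t => T.lfp t) m s) =
      T.lfp s := fun s => congrArg Subtype.val (congrFun T.map_lfp s)
  refine ⟨fun s => T.lfp s, fun s => (T.lfp s).2.1, fun s => (T.lfp s).2.2, fun s => ?_,
    fun f hf0 hfle hf => ?_⟩
  · simp only [Function.update_self]
    rw [← hfix s]
    refine ⟨G.exists_optimum_eq i s _, fun ho a ha => ?_, fun ho a ha => ?_⟩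
    · exact (G.optimum_of_owner_eq ho _).2 ⟨a, ha, rfl⟩
    · exact (G.optimum_of_owner_ne ho _).2 ⟨a, ha, rfl⟩
  · simp only [Function.update_self, Function.update_idem] at hfle hf ⊢
    have hle : T.lfp ≤ fun s => ⟨f s, hf0 s, (hfle s).trans (T.lfp s).2.2⟩ := by
      refine T.lfp_le fun s => ?_
      change G.optimum i s (G.after (Function.update w m f) m s) ≤ f s
      by_cases ho : G.owner s = i
      · obtain ⟨a, ha, hga⟩ := (G.optimum_of_owner_eq ho
          (G.after (Function.update w m f) m s)).1
        exact hga ▸ (hf s).1 ho a ha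
      · obtain ⟨a, ha, hga⟩ := (hf s).2 ho
        exact ((G.optimum_of_owner_ne ho _).2 ⟨a, ha, rfl⟩).trans hga
    exact funext fun s => le_antisymm (hfle s) (hle s)

/-- The value of the weak parity game, as a function of the greatest color seen and of the current
state. -/
theorem exists_value : ∃ v : ℕ → S → ℝ, (∀ m s, 0 ≤ v m s) ∧ (∀ m s, v m s ≤ 1) ∧
    (∀ m, G.IsValueAt v m) ∧ ∀ m, (∀ s a, G.col s a ≤ m) → v m = terminalValue m := by
  obtain ⟨B, hB⟩ := G.exists_col_le
  suffices h : ∀ k, ∃ v : ℕ → S → ℝ, (∀ m s, 0 ≤ v m s) ∧ (∀ m s, v m s ≤ 1) ∧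
      (∀ m, B ≤ m + k → G.IsValueAt v m) ∧
      ∀ m, (∀ s a, G.col s a ≤ m) → v m = terminalValue m by
    obtain ⟨v, h0, h1, h2, h3⟩ := h B
    exact ⟨v, h0, h1, fun m => h2 m (by omega), h3⟩
  intro k
  induction k with
  | zero =>
    refine ⟨terminalValue, fun m s => ?_, fun m s => ?_, fun m hm => ?_, fun m hm => rfl⟩
    · unfold terminalValue; split_ifs <;> norm_num
    · unfold terminalValue; split_ifs <;> norm_num
    · exact G.isValueAt_terminalValue fun s a => (hB s a).trans hm
  | succ k ih =>
    obtain ⟨v, h0, h1, h2, h3⟩ := ih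
    -- All levels are already solved here; without this case the truncated `B - (k + 1)` would
    -- select level 0 again.
    by_cases hk : B ≤ k
    · exact ⟨v, h0, h1, fun m _ => h2 m (by omega), h3⟩
    -- A level below `B` may still bound all colors, since `B` need not be attained. There the
    -- terminal value must be kept, as the last clause of the induction demands.
    by_cases hcol : ∀ s a, G.col s a ≤ B - (k + 1)
    · exact ⟨v, h0, h1, fun m hm => (G.isValueAt_terminalValue fun s a =>
        (hcol s a).trans (by omega)).congr G fun m' hm' =>
          (h3 m' fun s a => (hcol s a).trans (by omega)).symm, h3⟩
    set m := B - (k + 1) with hm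
    -- The level is solved from the side of the player for whom it is bad, since that player's value
    -- is the least solution; `sideValue` then translates back.
    obtain ⟨i, hi⟩ := exists_not_goodFor m
    obtain ⟨f, hf0, hf1, hf, hf'⟩ := G.exists_solution i (sideValue v i) m
      (fun m s => (sideValue_mem h0 h1 i m s).1) (fun m s => (sideValue_mem h0 h1 i m s).2)
    let v' := sideValue (Function.update (sideValue v i) m f) i
    have hv' : ∀ m', m' ≠ m → v' m' = v m' := by
      intro m' hne
      have := sideValue_congr (Function.update_of_ne hne f (sideValue v i)) i
      rwa [sideValue_sideValue] at this
    have hmem := sideValue_mem (v := Function.update (sideValue v i) m f) (fun k s => ?_)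
      (fun k s => ?_) i
    · refine ⟨v', fun m s => (hmem m s).1, fun m s => (hmem m s).2, fun m' hm' => ?_,
        fun m' hm' => ?_⟩
      · rcases eq_or_ne m' m with rfl | hne
        · refine IsValueAt.of_side G hi ?_ ?_
          · rwa [sideValue_sideValue]
          · rwa [sideValue_sideValue]
        · exact (h2 m' (by omega)).congr G fun m'' h'' => (hv' m'' (by omega)).symm
      · rw [hv' m' (fun h => hcol (h ▸ hm')), h3 m' hm']
    · rcases eq_or_ne k m with rfl | hne
      · simpa using hf0 s
      · simpa [hne] using (sideValue_mem h0 h1 i k s).1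
    · rcases eq_or_ne k m with rfl | hne
      · simpa using hf1 s
      · simpa [hne] using (sideValue_mem h0 h1 i k s).2

end Arena

/-! ### Ranks and optimal strategies extracted from the value -/

namespace Arena

variable {S : Type u} {A : Type v} (G : Arena S A)

/-- The strategy that plays `nxt` on the greatest color seen and the current state, if the past had
greatest color `m`. -/
noncomputable def playStrat (m : ℕ) (nxt : ℕ → S → A) : Strat S A := fun s l =>
  PMF.pure (nxt (G.maxHist s m l) (lastState s l))

lemma playStrat_mem_strategies {nxt : ℕ → S → A} (h : ∀ m s, nxt m s ∈ G.avail s) (m : ℕ)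
    (X : StratType) (I : Set S) (i : Player) : G.playStrat m nxt ∈ G.strategies X I i := by
  refine ⟨fun s l _ => ?_, fun _ s l _ => ⟨_, PMF.support_pure _⟩⟩
  rw [playStrat, PMF.support_pure, Set.singleton_subset_iff]
  exact h _ _

lemma playStrat_follows (i : Player) (s : S) (m : ℕ) (nxt : ℕ → S → A) :
    G.Follows i s m nxt (G.playStrat m nxt) := fun _ _ _ => rfl

lemma strategies_mono {X : StratType} {I J : Set S} (hIJ : J ⊆ I) {i : Player} {σ : Strat S A}
    (hσ : σ ∈ G.strategies X I i) : σ ∈ G.strategies X J i :=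
  ⟨fun s l h => hσ.1 s l ⟨hIJ h.1, h.2⟩, fun hX s l h => hσ.2 hX s l ⟨hIJ h.1, h.2⟩⟩

lemma shiftStrat_mem_strategies {X : StratType} {I : Set S} {i : Player} {σ : Strat S A}
    (hσ : σ ∈ G.strategies X I i) {s : S} (hs : s ∈ I) {l : List (Move S A)} (hl : G.IsPath s l) :
    shiftStrat σ s l ∈ G.strategies X {lastState s l} i := by
  have key : ∀ t l', G.IsHistOf {lastState s l} i t l' →
      lastState s (l ++ l') = lastState t l' ∧ G.IsHistOf I i s (l ++ l') := by
    rintro t l' ⟨rfl, h1, h2⟩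
    rw [IsHistOf, lastState_append, isPath_append]
    exact ⟨rfl, hs, ⟨hl, h1⟩, h2⟩
  refine ⟨fun t l' h => ?_, fun hX t l' h => hσ.2 hX _ _ (key t l' h).2⟩
  rw [← (key t l' h).1]
  exact hσ.1 _ _ (key t l' h).2

@[simp] lemma shiftPref_nil (pref : Pref) : shiftPref pref [] = pref := by
  funext μ μ'
  simp [shiftPref]

/-- The opponent of a player. -/
def opponent : Player → Player
  | Player.one => Player.two
  | Player.two => Player.one

lemma ne_opponent (i : Player) : i ≠ opponent i := by cases i <;> simp [opponent]

variable [Finite S] [Finite A]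

/-- At a level that is bad for player `i`, playing optimally ensures progress with respect to some
rank from the states of positive value. -/
lemma exists_rank {i : Player} {w : ℕ → S → ℝ} {m : ℕ} (h0 : ∀ s, 0 ≤ w m s)
    (hb : G.IsBellman i w m) (hl : G.IsLeastSolution i w m) :
    ∃ r : S → ℕ, ∀ s, 0 < w m s →
      (G.owner s = i → ∃ a ∈ G.avail s, G.after w m s a = w m s ∧
        ∃ t, 0 < G.δ s a t ∧ (m < G.col s a ∨ r t < r s)) ∧
      (G.owner s ≠ i → ∀ a ∈ G.avail s, G.after w m s a = w m s →
        ∃ t, 0 < G.δ s a t ∧ (m < G.col s a ∨ r t < r s)) := by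
  classical
  -- An attractor restricted to value-preserving actions: starting from the states of value 0, it
  -- adds those from which a level change or an earlier layer is reachable with positive
  -- probability, by some such action for player `i` and by every such action for the opponent.
  let attr : Set S → Set S := fun R => {s |
    (G.owner s = i → ∃ a ∈ G.avail s, G.after w m s a = w m s ∧
      ∃ t, 0 < G.δ s a t ∧ (m < G.col s a ∨ t ∈ R)) ∧
    (G.owner s ≠ i → ∀ a ∈ G.avail s, G.after w m s a = w m s →
      ∃ t, 0 < G.δ s a t ∧ (m < G.col s a ∨ t ∈ R))}
  let R : ℕ → Set S := fun k => (fun R => R ∪ attr R)^[k] {s | ¬ 0 < w m s}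
  have hsucc : ∀ k, R (k + 1) = R k ∪ attr (R k) := fun k => Function.iterate_succ_apply' _ k _
  have hR : Monotone R := monotone_nat_of_le_succ fun k => hsucc k ▸ Set.subset_union_left
  obtain ⟨n, hn⟩ := WellFoundedGT.monotone_chain_condition (⟨R, hR⟩ : ℕ →o Set S)
  have hn : R (n + 1) = R n := (hn (n + 1) (Nat.le_succ n)).symm
  have hcl : attr (R n) ⊆ R n :=
    (Set.subset_union_right : _ ⊆ R n ∪ attr (R n)).trans (hsucc n ▸ hn.le)
  have hall : ∀ s, s ∈ R n := by
    obtain ⟨ε₁, hε₁, h₁⟩ := exists_pos_lower_bound (w m)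
    obtain ⟨ε₂, hε₂, h₂⟩ := exists_pos_lower_bound
      fun x : S × A => w m x.1 - G.after w m x.1 x.2
    set ε := min ε₁ ε₂
    have hε : 0 < ε := lt_min hε₁ hε₂
    -- If the stable layer `R n` missed a state, lowering `w` by `ε` outside it would give a
    -- strictly smaller subsolution: value-preserving actions that avoid `R n` and level changes
    -- lose exactly `ε` too, and suboptimal actions have slack at least `ε₂ ≥ ε`. This contradicts
    -- leastness.
    let f : S → ℝ := fun s => if s ∈ R n then w m s else w m s - ε
    have hfle : ∀ s, f s ≤ w m s := fun s => by
      simp only [f]; split_ifs <;> linarith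
    have hpos : ∀ s, s ∉ R n → 0 < w m s := fun s hs => by
      by_contra hc
      exact hs (hR (Nat.zero_le n) hc)
    have hle : ∀ s a, G.after (Function.update w m f) m s a ≤ G.after w m s a := fun s a =>
      G.after_mono (fun k _ t => by
        by_cases hk : k = m
        · rw [hk, Function.update_self]; exact hfle t
        · rw [Function.update_of_ne hk]) s a
    have hstay : ∀ s a, (¬ ∃ t, 0 < G.δ s a t ∧ (m < G.col s a ∨ t ∈ R n)) →
        G.after (Function.update w m f) m s a ≤ G.after w m s a - ε := by
      intro s a hs
      have e : G.after w m s a - ε = expect (G.δ s a) fun t =>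
          w (max m (G.col s a)) t - ε := by rw [expect_sub, expect_const, after]
      rw [e]
      refine expect_mono fun t ht => ?_
      have hc : max m (G.col s a) = m := max_eq_left (not_lt.1 fun hc => hs ⟨t, ht, .inl hc⟩)
      have hf : f t = w m t - ε := if_neg fun hc => hs ⟨t, ht, .inr hc⟩
      rw [hc, Function.update_self, hf]
    have hfw := hl f (fun s => ?_) hfle fun s => ?_
    · intro s
      by_contra hs
      have : f s = w m s - ε := if_neg hs
      rw [hfw] at this
      linarith
    · simp only [f]
      split_ifs with hs
      · exact h0 s
      · linarith [h₁ s (hpos s hs), min_le_left ε₁ ε₂]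
    · by_cases hs : s ∈ R n
      · have hf : f s = w m s := if_pos hs
        rw [hf]
        refine ⟨fun ho a ha => (hle s a).trans ((hb s).2.1 ho a ha), fun _ => ?_⟩
        obtain ⟨a, ha, hw⟩ := (hb s).1
        exact ⟨a, ha, (hle s a).trans hw.le⟩
      · have hf : f s = w m s - ε := if_neg hs
        rw [hf]
        have hs' : ¬ s ∈ attr (R n) := fun h => hs (hcl h)
        refine ⟨fun ho a ha => ?_, fun ho => ?_⟩
        · rcases ((hb s).2.1 ho a ha).eq_or_lt with heq | hlt
          · rw [← heq]
            exact hstay s a fun hex => hs' ⟨fun _ => ⟨a, ha, heq, hex⟩, fun ho' => absurd ho ho'⟩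
          · have := h₂ (s, a) (sub_pos.2 hlt)
            simp only at this
            linarith [hle s a, min_le_right ε₁ ε₂]
        · by_contra hc
          push Not at hc
          refine hs' ⟨fun ho' => absurd ho' ho, fun _ a ha heq => ?_⟩
          by_contra hex
          linarith [hc a ha, hstay s a hex]
  -- The rank is the index of the first layer containing the state. Positive value excludes layer 0,
  -- so the state was added by `attr` and can reach a strictly earlier layer or change the level.
  refine ⟨fun s => sInf {k | s ∈ R k}, fun s hs => ?_⟩
  have hmem : s ∈ R (sInf {k | s ∈ R k}) := Nat.sInf_mem (s := {k | s ∈ R k}) ⟨n, hall s⟩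
  rcases hk : sInf {k | s ∈ R k} with _ | k
  · rw [hk] at hmem
    exact absurd hs hmem
  · rw [hk] at hmem
    have hnot : s ∉ R k := fun h => by
      have := Nat.sInf_le (s := {k | s ∈ R k}) h
      omega
    have hat := ((hsucc k ▸ hmem : s ∈ R k ∪ attr (R k)).resolve_left hnot : s ∈ attr (R k))
    have hlt : ∀ t, t ∈ R k → sInf {k | t ∈ R k} < k + 1 := fun t ht =>
      Nat.lt_succ_of_le (Nat.sInf_le ht)
    beta_reduce
    rw [hk]
    refine ⟨fun ho => ?_, fun ho a ha heq => ?_⟩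
    · obtain ⟨a, ha, heq, t, ht, h⟩ := hat.1 ho
      exact ⟨a, ha, heq, t, ht, h.imp_right (hlt t)⟩
    · obtain ⟨t, ht, h⟩ := hat.2 ho a ha heq
      exact ⟨t, ht, h.imp_right (hlt t)⟩

/-- Optimal strategies are certified. -/
theorem exists_isCertificate {v : ℕ → S → ℝ} (h0 : ∀ m s, 0 ≤ v m s) (h1 : ∀ m s, v m s ≤ 1)
    (hv : ∀ m, G.IsValueAt v m) (i : Player) :
    ∃ r nxt, G.IsCertificate i (sideValue v i) r nxt := by
  set w := sideValue v i
  have hw := sideValue_mem h0 h1 i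
  have hr : ∀ m, ∃ r : S → ℕ, ¬ goodFor i m → ∀ s, 0 < w m s →
      (G.owner s = i → ∃ a ∈ G.avail s, G.after w m s a = w m s ∧
        ∃ t, 0 < G.δ s a t ∧ (m < G.col s a ∨ r t < r s)) ∧
      (G.owner s ≠ i → ∀ a ∈ G.avail s, G.after w m s a = w m s →
        ∃ t, 0 < G.δ s a t ∧ (m < G.col s a ∨ r t < r s)) := by
    intro m
    by_cases hg : goodFor i m
    · exact ⟨fun _ => 0, fun h => absurd hg h⟩
    · obtain ⟨r, hr⟩ := G.exists_rank (fun s => (hw m s).1) ((hv m).bellman i)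
        ((hv m).least i hg)
      exact ⟨r, fun _ => hr⟩
  choose r hr using hr
  have hnxt : ∀ m s, ∃ a ∈ G.avail s, G.after w m s a = w m s ∧
      (G.owner s = i → ¬ goodFor i m → 0 < w m s → G.Progress r m s a) := by
    intro m s
    by_cases h : G.owner s = i ∧ ¬ goodFor i m ∧ 0 < w m s
    · obtain ⟨a, ha, heq, hp⟩ := (hr m h.2.1 s h.2.2).1 h.1
      exact ⟨a, ha, heq, fun _ _ _ => hp⟩
    · obtain ⟨a, ha, heq⟩ := ((hv m).bellman i s).1
      exact ⟨a, ha, heq, fun h₁ h₂ h₃ => absurd ⟨h₁, h₂, h₃⟩ h⟩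
  choose nxt hav heq hprog using hnxt
  refine ⟨r, nxt, fun m s => (hw m s).1, fun m s => (hw m s).2, hav, fun m s a ha hn => ?_,
    fun m s a ha hn he hg hp => ?_⟩
  · by_cases ho : G.owner s = i
    · exact hn ho ▸ (heq m s).ge
    · exact ((hv m).bellman i s).2.2 ho a ha
  · by_cases ho : G.owner s = i
    · exact hn ho ▸ hprog m s ho hg hp
    · exact (hr m hg s hp).2 ho a ha he

/-! ### Optimal strategies -/

lemma measureReal_winEvent_two (s : S) (u : List ℕ) (σ₁ σ₂ : Strat S A) :
    (G.playMeasure s σ₁ σ₂).real (G.winEvent Player.two s (u.foldl max 0)) =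
      1 - (G.playMeasure s σ₁ σ₂).real (G.winEvent Player.one s (u.foldl max 0)) := by
  rw [winEvent_two, probReal_compl_eq_one_sub (G.measurableSet_winEvent _ _ _)]

/-- A strategy that follows a certificate for the value `v`, from the state `s` with past `u`, is
optimal, since the other player has a certificate as well. -/
theorem atLeastAsGood_of_follows {v : ℕ → S → ℝ} {r r' : ℕ → S → ℕ} {nxt nxt' : ℕ → S → A}
    {i j : Player} (hij : i ≠ j) (h : G.IsCertificate i (sideValue v i) r nxt)
    (h' : G.IsCertificate j (sideValue v j) r' nxt') {X : StratType} {s : S} {u : List ℕ}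
    {σ σ' : Strat S A} (hσ : σ ∈ G.strategies X {s} i) (hσ' : σ' ∈ G.strategies X {s} i)
    (hf : G.Follows i s (u.foldl max 0) nxt σ) :
    G.AtLeastAsGood (shiftPref (prefOf weakParity) u) X s i σ σ' := by
  set m := u.foldl max 0 with hm
  -- The opponent's certified strategy is the witness against every competitor `σ'`: it holds `σ'`
  -- to the value, while `σ` secures at least the value against anyone.
  have hnxt' := G.playStrat_mem_strategies h'.avail m X {s} j
  have hf' := G.playStrat_follows j s m nxt'
  have hone : ∀ {σ₁ σ₂ : Strat S A} {x : ℝ},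
      x ≤ (G.playMeasure s σ₁ σ₂).real (G.winEvent Player.one s m) →
        ENNReal.ofReal x ≤ (G.outcome s σ₁ σ₂).map (prepend u) weakParity := by
    intro σ₁ σ₂ x hx
    rw [outcome_map_prepend, ← ofReal_measureReal]
    exact ENNReal.ofReal_le_ofReal hx
  have htwo : ∀ {σ₁ σ₂ : Strat S A} {x : ℝ},
      1 - x ≤ (G.playMeasure s σ₁ σ₂).real (G.winEvent Player.two s m) →
        (G.outcome s σ₁ σ₂).map (prepend u) weakParity ≤ ENNReal.ofReal x := by
    intro σ₁ σ₂ x hx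
    rw [measureReal_winEvent_two] at hx
    rw [outcome_map_prepend, ← ofReal_measureReal]
    exact ENNReal.ofReal_le_ofReal (by linarith)
  cases i <;> cases j
  · exact absurd rfl hij
  · rintro μ ⟨hμ, σ₂, hσ₂, hle⟩
    refine ⟨hμ, _, hnxt', ?_⟩
    have h1 := h.le_measureReal_winEvent G (u := u) hσ.1 hσ₂.1 hf
    have h2 := h'.le_measureReal_winEvent G (u := u) hσ'.1 hnxt'.1 hf'
    exact ((htwo h2).trans (hone h1)).trans hle
  · rintro μ ⟨hμ, σ₁, hσ₁, hle⟩
    refine ⟨hμ, _, hnxt', ?_⟩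
    have h1 := h.le_measureReal_winEvent G (u := u) hσ₁.1 hσ.1 hf
    have h2 := h'.le_measureReal_winEvent G (u := u) hnxt'.1 hσ'.1 hf'
    exact hle.trans ((htwo h1).trans (hone h2))
  · exact absurd rfl hij

/-- Playing according to a certificate for the value is optimal and subgame perfect. -/
theorem playStrat_optimal {v : ℕ → S → ℝ} {r r' : ℕ → S → ℕ} {nxt nxt' : ℕ → S → A}
    {i j : Player} (hij : i ≠ j) (h : G.IsCertificate i (sideValue v i) r nxt)
    (h' : G.IsCertificate j (sideValue v j) r' nxt') (X : StratType) (I : Set S) :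
    G.IsOptimal (prefOf weakParity) X I i (G.playStrat 0 nxt) ∧
      G.IsSubgamePerfect (prefOf weakParity) X I i (G.playStrat 0 nxt) := by
  have hmem := G.playStrat_mem_strategies h.avail 0 X I i
  refine ⟨⟨hmem, fun σ' hσ' s hs => ?_⟩, hmem, fun s hs l hl =>
    ⟨G.shiftStrat_mem_strategies hmem hs hl, ?_⟩⟩
  · have hsub : {s} ⊆ I := Set.singleton_subset_iff.2 hs
    have := G.atLeastAsGood_of_follows hij h h' (u := []) (G.strategies_mono hsub hmem)
      (G.strategies_mono hsub hσ') (G.playStrat_follows i s 0 nxt)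
    rwa [shiftPref_nil] at this
  · rintro σ' hσ' t rfl
    refine G.atLeastAsGood_of_follows hij h h' (G.shiftStrat_mem_strategies hmem hs hl) hσ'
      fun l' _ _ => ?_
    -- The running maximum after a concatenation continues from the maximum of the first part, so
    -- the shifted strategy follows the same certificate with the new past.
    change PMF.pure _ = _
    rw [maxHist_append, lastState_append]
    rfl

theorem exists_optimal_basedOn_maxSkeleton (I : Set S) (i : Player) :
    ∃ σ : Strat S A, G.IsPure I i σ ∧ G.IsBasedOn maxSkeleton I i σ ∧
      G.IsOptimal (prefOf weakParity) StratType.general I i σ ∧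
      G.IsSubgamePerfect (prefOf weakParity) StratType.general I i σ := by
  obtain ⟨v, h0, h1, hv, -⟩ := G.exists_value
  obtain ⟨r, nxt, h⟩ := G.exists_isCertificate h0 h1 hv i
  obtain ⟨r', nxt', h'⟩ := G.exists_isCertificate h0 h1 hv (opponent i)
  refine ⟨G.playStrat 0 nxt, (G.playStrat_mem_strategies h.avail 0 StratType.pure I i).2 rfl,
    ⟨fun s m => PMF.pure (nxt m s), fun s m _ => ?_, fun s l _ => rfl⟩,
    G.playStrat_optimal (ne_opponent i) h h' StratType.general I⟩
  rw [PMF.support_pure, Set.singleton_subset_iff]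
  exact h.avail m s

end Arena

/-! ### Deterministic arenas: ordering pasts by hardness -/

lemma expect_of_support_eq {α : Type*} [Finite α] {p : PMF α} {a : α} (h : p.support = {a})
    (f : α → ℝ) : expect p f = f a := by
  rw [expect_congr (g := fun _ => f a), expect_const]
  intro b hb
  have : b ∈ p.support := (PMF.mem_support_iff _ _).2 hb.ne'
  rw [h, Set.mem_singleton_iff] at this
  rw [this]

/-- How hard it is for player `i` to win after having seen the greatest color `m`. -/
noncomputable def hardness (i : Player) (m : ℕ) : ℤ :=
  open Classical in if goodFor i m then -m - 1 else m

lemma hardness_of_good {i : Player} {m : ℕ} (h : goodFor i m) : hardness i m = -m - 1 := if_pos h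

lemma hardness_of_bad {i : Player} {m : ℕ} (h : ¬ goodFor i m) : hardness i m = m := if_neg h

lemma hardness_mem (i : Player) (m : ℕ) : -m - 1 ≤ hardness i m ∧ hardness i m ≤ m := by
  unfold hardness
  split_ifs <;> omega

lemma hardness_lt_zero_iff {i : Player} {m : ℕ} : hardness i m < 0 ↔ goodFor i m := by
  by_cases h : goodFor i m
  · simp only [hardness_of_good h, h, iff_true]; omega
  · simp [hardness_of_bad h, h]

lemma hardness_injective (i : Player) : Function.Injective (hardness i) := by
  intro m m' h
  unfold hardness at h
  split_ifs at h <;> omega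

/-- From easiest to hardest the order runs through the good colors downwards, then the bad colors
upwards. A color between two levels replaces the lower one only, and the higher one is extreme among
the colors up to it: easiest if good, hardest if bad. -/
lemma hardness_max_mono {i : Player} {m m' : ℕ} (x : ℕ) (h : hardness i m ≤ hardness i m') :
    hardness i (max m x) ≤ hardness i (max m' x) := by
  have hx := hardness_mem i x
  have hm := hardness_mem i m
  have hm' := hardness_mem i m'
  rcases le_total m x with h1 | h1 <;> rcases le_total m' x with h2 | h2
  · rw [max_eq_right h1, max_eq_right h2]
  · rw [max_eq_right h1, max_eq_left h2]
    rcases h2.eq_or_lt with rfl | h2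
    · exact le_rfl
    · by_cases hg : goodFor i m'
      · rw [hardness_of_good hg] at h ⊢; omega
      · rw [hardness_of_bad hg] at h ⊢; omega
  · rw [max_eq_left h1, max_eq_right h2]
    rcases h1.eq_or_lt with rfl | h1
    · exact le_rfl
    · by_cases hg : goodFor i m
      · rw [hardness_of_good hg] at h ⊢; omega
      · rw [hardness_of_bad hg] at h ⊢; omega
  · rwa [max_eq_left h1, max_eq_left h2]

namespace Arena

variable {S : Type u} {A : Type v} (G : Arena S A)

lemma maxHist_eq_max (s : S) (m : ℕ) (l : List (Move S A)) :
    G.maxHist s m l = max m (G.maxHist s 0 l) := by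
  refine eq_of_forall_ge_iff fun k => ?_
  simp only [maxHist, foldl_max_le_iff, max_le_iff, Nat.zero_le, true_and]

lemma winEvent_subset {i : Player} {m m' : ℕ} (h : hardness i m ≤ hardness i m') (s : S) :
    G.winEvent i s m' ⊆ G.winEvent i s m := by
  intro π hπ
  refine Filter.Eventually.mono hπ fun n hn => ?_
  rw [maxHist_eq_max, ← hardness_lt_zero_iff] at hn ⊢
  exact (hardness_max_mono _ h).trans_lt hn

lemma sideValue_opponent (v : ℕ → S → ℝ) (i : Player) (m : ℕ) (s : S) :
    sideValue v (opponent i) m s = 1 - sideValue v i m s := by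
  cases i <;> simp [opponent, sideValue]

lemma IsDeterministic.exists_after_eq {G : Arena S A} [Finite S] (hG : G.IsDeterministic) {s : S} {a : A}
    (ha : a ∈ G.avail s) : ∃ t, (∀ t', 0 < G.δ s a t' → t' = t) ∧
      ∀ w m, G.after w m s a = w (max m (G.col s a)) t := by
  obtain ⟨t, ht⟩ := hG s a ha
  refine ⟨t, fun t' ht' => ?_, fun w m => expect_of_support_eq ht _⟩
  have : t' ∈ (G.δ s a).support := (PMF.mem_support_iff _ _).2 ht'.ne'
  rwa [ht] at this

variable [Finite S] [Finite A]

lemma measureReal_winEvent_opponent (i : Player) (s : S) (u : List ℕ) (σ₁ σ₂ : Strat S A) :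
    (G.playMeasure s σ₁ σ₂).real (G.winEvent (opponent i) s (u.foldl max 0)) =
      1 - (G.playMeasure s σ₁ σ₂).real (G.winEvent i s (u.foldl max 0)) := by
  have := G.measureReal_winEvent_two s u σ₁ σ₂
  cases i
  · exact this
  · change _ = 1 - (G.playMeasure s σ₁ σ₂).real (G.winEvent Player.two s (u.foldl max 0))
    rw [this]
    simp [opponent]

/-- The value decreases with the hardness of the past. -/
lemma sideValue_anti {v : ℕ → S → ℝ} {r r' : ℕ → S → ℕ} {nxt nxt' : ℕ → S → A} {i : Player}
    (h : G.IsCertificate i (sideValue v i) r nxt)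
    (h' : G.IsCertificate (opponent i) (sideValue v (opponent i)) r' nxt') {m m' : ℕ}
    (hm : hardness i m ≤ hardness i m') (s : S) : sideValue v i m' s ≤ sideValue v i m s := by
  have e : ∀ k : ℕ, [k].foldl max 0 = k := fun k => by simp
  -- One single play distribution is evaluated under both pasts: player `i` follows the certificate
  -- as if the past were `m'`, the opponent as if it were `m`. The inclusion of winning events then
  -- compares the two guarantees.
  obtain ⟨σ₁, σ₂, h1, h2, h3, h4⟩ : ∃ σ₁ σ₂, G.IsStrategy {s} Player.one σ₁ ∧
      G.IsStrategy {s} Player.two σ₂ ∧ G.Follows i s m' nxt (ofPlayer σ₁ σ₂ i) ∧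
      G.Follows (opponent i) s m nxt' (ofPlayer σ₁ σ₂ (opponent i)) := by
    have m1 := G.playStrat_mem_strategies h.avail m' StratType.general {s} i
    have m2 := G.playStrat_mem_strategies h'.avail m StratType.general {s} (opponent i)
    cases i
    · exact ⟨_, _, m1.1, m2.1, G.playStrat_follows _ _ _ _, G.playStrat_follows _ _ _ _⟩
    · exact ⟨_, _, m2.1, m1.1, G.playStrat_follows _ _ _ _, G.playStrat_follows _ _ _ _⟩
  rw [← e m'] at h3
  rw [← e m] at h4
  have k1 := h.le_measureReal_winEvent G h1 h2 h3
  have k2 := h'.le_measureReal_winEvent G h1 h2 h4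
  rw [measureReal_winEvent_opponent, sideValue_opponent] at k2
  rw [e] at k1 k2
  linarith [measureReal_mono (μ := G.playMeasure s σ₁ σ₂) (G.winEvent_subset hm s)]

variable {G}

/-- Induction from the top level down: a deterministic step only copies a value, so the indicator of
value 1 is again a subsolution below the value of the player for whom `m` is bad, and leastness
forces equality. -/
lemma IsDeterministic.value_eq_zero_or_one (hG : G.IsDeterministic) {v : ℕ → S → ℝ}
    (h0 : ∀ m s, 0 ≤ v m s) (h1 : ∀ m s, v m s ≤ 1) (hv : ∀ m, G.IsValueAt v m)
    (hterm : ∀ m, (∀ s a, G.col s a ≤ m) → v m = terminalValue m) (i : Player) (m : ℕ) (s : S) :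
    sideValue v i m s = 0 ∨ sideValue v i m s = 1 := by
  classical
  have hiff : ∀ i m s, (v m s = 0 ∨ v m s = 1) ↔
      (sideValue v i m s = 0 ∨ sideValue v i m s = 1) := by
    intro i m s
    cases i
    · rfl
    · simp only [sideValue, sub_eq_zero, sub_eq_self]
      rw [or_comm, eq_comm]
  obtain ⟨B, hB⟩ := G.exists_col_le
  rw [← hiff]
  obtain ⟨k, hk⟩ : ∃ k, B ≤ m + k := ⟨B, by omega⟩
  induction k using Nat.strong_induction_on generalizing m s with
  | _ k ih =>
  by_cases hm : ∀ s a, G.col s a ≤ m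
  · rw [hterm m hm]
    unfold terminalValue
    split_ifs <;> simp
  have hmB : m < B := by
    by_contra hc
    exact hm fun s a => (hB s a).trans (not_lt.1 hc)
  have hhigh : ∀ m' > m, ∀ s, v m' s = 0 ∨ v m' s = 1 := by
    intro m' hm' s
    by_cases hk0 : k = 0
    · omega
    · exact ih (k - 1) (by omega) m' s (by omega)
  obtain ⟨i, hi⟩ := exists_not_goodFor m
  set w := sideValue v i with hw
  have hmem := sideValue_mem h0 h1 i
  rw [hiff i]
  let f : S → ℝ := fun s => if w m s = 1 then 1 else 0
  have hf := (hv m).least i hi f (fun s => ?_) (fun s => ?_) (fun s => ?_)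
  · rw [show sideValue v i m s = f s from congrFun hf.symm s]
    simp only [f]
    split_ifs <;> simp
  · simp only [f]; split_ifs <;> norm_num
  · simp only [f]; split_ifs with h
    · exact h.ge
    · exact (hmem m s).1
  · have key : ∀ a ∈ G.avail s, G.after (Function.update w m f) m s a =
        if G.after w m s a = 1 then 1 else 0 := by
      intro a ha
      obtain ⟨t, -, ht⟩ := hG.exists_after_eq ha
      rw [ht, ht]
      by_cases hc : m < G.col s a
      · have hmax : max m (G.col s a) ≠ m := by omega
        rw [Function.update_of_ne hmax]
        rcases (hiff i _ _).1 (hhigh (max m (G.col s a)) (by omega) t) with h | h <;>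
          rw [← hw] at h <;> simp [h]
      · rw [max_eq_left (not_lt.1 hc), Function.update_self]
    have hle : ∀ x y : ℝ, x ≤ y → y ≤ 1 →
        (if x = 1 then (1 : ℝ) else 0) ≤ if y = 1 then 1 else 0 := by
      intro x y hxy hy
      split_ifs with h₁ h₂
      · exact le_rfl
      · exact absurd (le_antisymm hy (h₁ ▸ hxy)) h₂
      · exact zero_le_one
      · exact le_rfl
    refine ⟨fun ho a ha => ?_, fun ho => ?_⟩
    · rw [key a ha]
      exact hle _ _ (((hv m).bellman i s).2.1 ho a ha) (hmem m s).2
    · obtain ⟨a, ha, heq⟩ := ((hv m).bellman i s).1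
      refine ⟨a, ha, ?_⟩
      rw [key a ha]
      exact hle _ _ heq.le (hmem m s).2

/-- In deterministic arenas, a certificate that does not depend on the greatest color seen: play
optimally for the hardest past from which one can win. -/
theorem IsDeterministic.exists_memoryless_certificate (hG : G.IsDeterministic) {v : ℕ → S → ℝ}
    (h0 : ∀ m s, 0 ≤ v m s) (h1 : ∀ m s, v m s ≤ 1) (hv : ∀ m, G.IsValueAt v m)
    (hterm : ∀ m, (∀ s a, G.col s a ≤ m) → v m = terminalValue m) (i : Player) :
    ∃ (r : ℕ → S → ℕ) (nxt : S → A), G.IsCertificate i (sideValue v i) r fun _ => nxt := by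
  obtain ⟨r, nxt, h⟩ := G.exists_isCertificate h0 h1 hv i
  obtain ⟨r', nxt', h'⟩ := G.exists_isCertificate h0 h1 hv (opponent i)
  obtain ⟨B, hB⟩ := G.exists_col_le
  have hanti := fun m m' hm s => G.sideValue_anti h h' (m := m) (m' := m') hm s
  have h01 := hG.value_eq_zero_or_one h0 h1 hv hterm i
  have hbad : ∀ m ≥ B, ¬ goodFor i m → ∀ s, sideValue v i m s = 0 := by
    intro m hm hg s
    rw [sideValue_congr (hterm m fun s a => (hB s a).trans hm), sideValue_terminalValue hg]
  have hgood : ∀ m ≥ B, goodFor i m → ∀ s, sideValue v i m s = 1 := by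
    intro m hm hg s
    rw [sideValue_congr (hterm m fun s a => (hB s a).trans hm)]
    cases i <;> simp_all [sideValue, terminalValue, goodFor]
  set w := sideValue v i
  -- A hardest winning past exists: one of the levels `B`, `B + 1` is good and has value 1, while
  -- bad levels above `B` have value 0, so the hardness of winning pasts is bounded by `B`.
  have hhard : ∀ s, ∃ m, w m s = 1 ∧ ∀ m', w m' s = 1 → hardness i m' ≤ hardness i m := by
    intro s
    have hbdd : ∃ b : ℤ, ∀ z, (∃ m, w m s = 1 ∧ hardness i m = z) → z ≤ b := by
      refine ⟨B, ?_⟩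
      rintro z ⟨m, hm, rfl⟩
      by_cases hg : goodFor i m
      · rw [hardness_of_good hg]; omega
      · rw [hardness_of_bad hg]
        by_contra hc
        have := hbad m (by omega) hg s
        rw [hm] at this
        exact one_ne_zero this
    have hex : ∃ z, ∃ m, w m s = 1 ∧ hardness i m = z := by
      by_cases hg : goodFor i B
      · exact ⟨_, B, hgood B le_rfl hg s, rfl⟩
      · refine ⟨_, B + 1, hgood (B + 1) (by omega) ?_ s, rfl⟩
        cases i <;> simp_all [goodFor, Nat.even_add_one]
    obtain ⟨z, ⟨m, hm, rfl⟩, hz⟩ := Int.exists_greatest_of_bdd hbdd hex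
    exact ⟨m, hm, fun m' hm' => hz _ ⟨m', hm', rfl⟩⟩
  choose m hm1 hmax using hhard
  have hmB : ∀ s, hardness i (m s) ≤ B := by
    intro s
    by_cases hg : goodFor i (m s)
    · rw [hardness_of_good hg]; omega
    · rw [hardness_of_bad hg]
      by_contra hc
      have := hbad (m s) (by omega) hg s
      rw [hm1] at this
      exact one_ne_zero this
  obtain ⟨R, hR⟩ := (Set.finite_range fun x : S × S => r (m x.1) x.2).bddAbove
  have hR : ∀ s t, r (m s) t ≤ R := fun s t => hR ⟨(s, t), rfl⟩
  -- Lexicographic: first how far the hardest winning past is from the bound `B`, then the old rank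
  -- at that level; the factor `R + 1` exceeds all old ranks involved.
  let rank : S → ℕ := fun s => (B - hardness i (m s)).toNat * (R + 1) + r (m s) s
  have hnext : ∀ s, ∀ a ∈ G.avail s, (G.owner s = i → a = nxt (m s) s) → ∃ t,
      (∀ t', 0 < G.δ s a t' → t' = t) ∧ (∀ k, G.after w k s a = w (max k (G.col s a)) t) ∧
        w (max (m s) (G.col s a)) t = 1 := by
    intro s a ha hn
    obtain ⟨t, ht, hw⟩ := hG.exists_after_eq ha
    refine ⟨t, ht, hw w, le_antisymm (h.le_one _ _) ?_⟩
    rw [← hw w, ← hm1 s]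
    exact h.le_after _ _ a ha hn
  refine ⟨fun _ => rank, fun s => nxt (m s) s, h.nonneg, h.le_one, fun _ s => h.avail _ s,
    fun k s a ha hn => ?_, fun k s a ha hn _ hk hpos => ?_⟩
  · obtain ⟨t, -, hw, ht⟩ := hnext s a ha hn
    rcases h01 k s with hk | hk
    · rw [hk, hw]
      exact h.nonneg _ _
    · rw [hk, hw, ← ht]
      exact hanti _ _ (hardness_max_mono _ (hmax s k hk)) t
  · have hk1 : w k s = 1 := (h01 k s).resolve_left hpos.ne'
    have hkm := hmax s k hk1
    rw [hardness_of_bad hk] at hkm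
    have hmbad : ¬ goodFor i (m s) := by
      rw [← hardness_lt_zero_iff]; omega
    rw [hardness_of_bad hmbad] at hkm
    obtain ⟨t, htu, hw, ht⟩ := hnext s a ha hn
    obtain ⟨t', ht', hp⟩ := h.progress (m s) s a ha hn (by rw [hw, ht, hm1]) hmbad
      (by rw [hm1]; exact one_pos)
    obtain rfl := htu t' ht'
    refine ⟨t', ht', ?_⟩
    by_cases hc : m s < G.col s a
    · left; omega
    right
    have hr := hp.resolve_left hc
    rw [max_eq_left (not_lt.1 hc)] at ht
    have hle := hmax t' _ ht
    have hB1 := hmB t'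
    simp only [rank]
    -- The past `m s` still wins at the successor, so the hardest winning past there is at least as
    -- hard. If equally hard it is the same level, and the old rank drops; otherwise the first
    -- component drops.
    rcases hle.eq_or_lt with heq | hlt
    · rw [← hardness_injective i heq]
      omega
    · have h5 : (B - hardness i (m t')).toNat + 1 ≤ (B - hardness i (m s)).toNat := by omega
      have h6 := Nat.mul_le_mul_right (R + 1) h5
      have h7 := hR t' t'
      rw [add_mul] at h6
      omega

theorem IsDeterministic.exists_optimal_memoryless (hG : G.IsDeterministic) (I : Set S) (i : Player) :
    ∃ σ : Strat S A, G.IsPure I i σ ∧ G.IsMemoryless I i σ ∧ ∀ X : StratType,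
      G.IsOptimal (prefOf weakParity) X I i σ ∧
      G.IsSubgamePerfect (prefOf weakParity) X I i σ := by
  obtain ⟨v, h0, h1, hv, hterm⟩ := G.exists_value
  obtain ⟨r, nxt, h⟩ := hG.exists_memoryless_certificate h0 h1 hv hterm i
  obtain ⟨r', nxt', h'⟩ := G.exists_isCertificate h0 h1 hv (opponent i)
  refine ⟨G.playStrat 0 fun _ => nxt,
    (G.playStrat_mem_strategies h.avail 0 StratType.pure I i).2 rfl, fun s l s' l' _ _ he => ?_,
    fun X => G.playStrat_optimal (ne_opponent i) h h' X I⟩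
  rw [playStrat, playStrat, he]

end Arena

/-! ### An arena where memory is needed -/

/-- A fair coin toss between two outcomes. -/
noncomputable def coin {α : Type*} (x y : α) : PMF α :=
  (PMF.uniformOfFintype Bool).map fun b => if b then x else y

lemma expect_coin {α : Type*} [Finite α] (x y : α) (f : α → ℝ) :
    expect (coin x y) f = (f x + f y) / 2 := by
  rw [coin, expect_map, expect_eq_sum]
  simp [PMF.uniformOfFintype_apply]
  ring

lemma coin_left_pos {α : Type*} (x y : α) : 0 < coin x y x :=
  pos_iff_ne_zero.2 ((PMF.mem_support_iff _ _).1 ((PMF.mem_support_map_iff _ _ _).2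
    ⟨true, by simp, rfl⟩))

lemma coin_right_pos {α : Type*} (x y : α) : 0 < coin x y y :=
  pos_iff_ne_zero.2 ((PMF.mem_support_iff _ _).1 ((PMF.mem_support_map_iff _ _ _).2
    ⟨false, by simp, rfl⟩))

/-- The states of an arena in which the action at `choice` has to depend on whether `detour`, which
has color two, has been visited. -/
inductive CoinState : Type
  | start | detour | choice | halt | two | three
  deriving DecidableEq

namespace CoinState

instance : Fintype CoinState :=
  ⟨{start, detour, choice, halt, two, three}, fun s => by cases s <;> simp⟩

/-- At `choice`, the action `true` moves to a sink of color `0`, and the action `false` tosses a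
coin between sinks of colors `2` and `3`. -/
noncomputable def arena : Arena CoinState Bool where
  owner _ := Player.one
  avail
    | choice => Set.univ
    | _ => {true}
  δ
    | start, _ => coin choice detour
    | detour, _ => PMF.pure choice
    | choice, true => PMF.pure halt
    | choice, false => coin two three
    | halt, _ => PMF.pure halt
    | two, _ => PMF.pure two
    | three, _ => PMF.pure three
  col
    | start, _ => 1
    | detour, _ => 2
    | choice, _ => 0
    | halt, _ => 0
    | two, _ => 2
    | three, _ => 3
  avail_nonempty s := by cases s <;> exact ⟨true, by simp⟩

lemma true_mem_avail (s : CoinState) : true ∈ arena.avail s := by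
  cases s <;> simp [arena]

lemma eq_true_of_mem_avail {s : CoinState} (hs : s ≠ choice) {a : Bool} (ha : a ∈ arena.avail s) :
    a = true := by
  cases s <;> simp_all [arena]

section after
variable (w : ℕ → CoinState → ℝ) (m : ℕ) (a : Bool)

lemma after_start : arena.after w m start a = (w (max m 1) choice + w (max m 1) detour) / 2 :=
  expect_coin _ _ _

lemma after_detour : arena.after w m detour a = w (max m 2) choice := expect_pure _ _

lemma after_choice_true : arena.after w m choice true = w m halt := by
  change expect (PMF.pure halt) (w (max m 0)) = _
  rw [expect_pure, max_eq_left (Nat.zero_le m)]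

lemma after_choice_false : arena.after w m choice false = (w m two + w m three) / 2 := by
  change expect (coin two three) (w (max m 0)) = _
  rw [expect_coin, max_eq_left (Nat.zero_le m)]

lemma after_halt : arena.after w m halt a = w m halt := by
  conv_rhs => rw [← max_eq_left (Nat.zero_le m)]
  exact expect_pure halt (w (max m 0))

lemma after_two : arena.after w m two a = w (max m 2) two := expect_pure _ _

lemma after_three : arena.after w m three a = w (max m 3) three := expect_pure _ _

end after

/-- The value of a play with greatest color `m`. -/
noncomputable def parityValue (m : ℕ) : ℝ := if Even m then 1 else 0

lemma parityValue_mem (m : ℕ) : 0 ≤ parityValue m ∧ parityValue m ≤ 1 := by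
  unfold parityValue; split_ifs <;> norm_num

/-- The value of the game, if it has value `c m` at `choice`, the greatest color seen being `m`. -/
noncomputable def value (c : ℕ → ℝ) (m : ℕ) : CoinState → ℝ
  | start => (c (max m 1) + c (max m 2)) / 2
  | detour => c (max m 2)
  | choice => c m
  | halt => parityValue m
  | two => parityValue (max m 2)
  | three => parityValue (max m 3)

/-- The optimal value at `choice`. -/
noncomputable def choiceValue (m : ℕ) : ℝ :=
  max (parityValue m) ((parityValue (max m 2) + parityValue (max m 3)) / 2)

/-- The number of steps until the greatest color is reached. -/
def rank (m : ℕ) : CoinState → ℕ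
  | start => 4
  | detour => 3
  | choice => 2
  | halt => 0
  | two => 0
  | three => if m < 3 then 1 else 0

/-- At `choice`, it is optimal to stop if the greatest color seen is even. -/
def choose (m : ℕ) : CoinState → Bool
  | choice => decide (Even m)
  | _ => true

lemma choose_mem_avail (m : ℕ) (s : CoinState) : choose m s ∈ arena.avail s := by
  cases s
  case choice => exact Set.mem_univ _
  all_goals rfl

lemma choiceValue_mem (m : ℕ) : 0 ≤ choiceValue m ∧ choiceValue m ≤ 1 := by
  have h1 := parityValue_mem m
  have h2 := parityValue_mem (max m 2)
  have h3 := parityValue_mem (max m 3)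
  exact ⟨le_max_of_le_left h1.1, max_le h1.2 (by linarith)⟩

lemma value_mem {c : ℕ → ℝ} (hc : ∀ m, 0 ≤ c m ∧ c m ≤ 1) (m : ℕ) (s : CoinState) :
    0 ≤ value c m s ∧ value c m s ≤ 1 := by
  have := hc (max m 1)
  have := hc (max m 2)
  cases s <;> simp only [value, parityValue_mem, hc, and_self]
  constructor <;> linarith

lemma max_one_max_two (m : ℕ) : max (max m 1) 2 = max m 2 := by omega

/-- Up to `choice`, the rank always decreases. -/
lemma progress_of_rank {r : ℕ → CoinState → ℕ} {m : ℕ} {s : CoinState} {a : Bool}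
    (h1 : r m choice < r m start) (h2 : r m choice < r m detour) (h3 : r m halt < r m choice)
    (h4 : r m two < r m choice) (hs : s = start ∨ s = detour ∨ s = choice) :
    arena.Progress r m s a := by
  rcases hs with rfl | rfl | rfl
  · exact ⟨choice, coin_left_pos _ _, .inr h1⟩
  · exact ⟨choice, by simp [arena], .inr h2⟩
  · cases a
    · exact ⟨two, coin_left_pos _ _, .inr h4⟩
    · exact ⟨halt, by simp [arena], .inr h3⟩

lemma after_choose (m : ℕ) (s : CoinState) :
    arena.after (value choiceValue) m s (choose m s) = value choiceValue m s := by
  cases s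
  · simp only [after_start, value, max_one_max_two]
  · simp only [after_detour, value]
  · rcases Nat.even_or_odd m with h | h
    · have : choose m choice = true := decide_eq_true h
      rw [this, after_choice_true, value, value, choiceValue, max_eq_left (a := parityValue m)]
      have := parityValue_mem (max m 2)
      have := parityValue_mem (max m 3)
      rw [show parityValue m = 1 from if_pos h]
      linarith
    · have : choose m choice = false := decide_eq_false (Nat.not_even_iff_odd.2 h)
      rw [this, after_choice_false, value, value, value, choiceValue, max_eq_right (a := parityValue m)]
      have := parityValue_mem (max m 2)
      have := parityValue_mem (max m 3)
      rw [show parityValue m = 0 from if_neg (Nat.not_even_iff_odd.2 h)]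
      linarith
  · simp only [after_halt]
  · simp only [after_two, value, max_assoc, max_self]
  · simp only [after_three, value, max_assoc, max_self]

lemma after_le_value (m : ℕ) (s : CoinState) (a : Bool) :
    arena.after (value choiceValue) m s a ≤ value choiceValue m s := by
  cases s
  · simp only [after_start, value, max_one_max_two, le_refl]
  · simp only [after_detour, value, le_refl]
  · cases a
    · rw [after_choice_false]
      exact le_max_right _ _
    · rw [after_choice_true]
      exact le_max_left _ _
  · simp only [after_halt, le_refl]
  · simp only [after_two, value, max_assoc, max_self, le_refl]
  · simp only [after_three, value, max_assoc, max_self, le_refl]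

/-- A sink either has a color above `m`, or is already decided at level `m`, and then a positive
value contradicts badness. The other states lower the rank under any action, so one argument serves
both players. -/
lemma progress {i : Player} {m : ℕ} (hi : ¬ goodFor i m) {s : CoinState} {a : Bool}
    (hpos : 0 < Arena.sideValue (value choiceValue) i m s) :
    arena.Progress (fun _ => rank 0) m s a := by
  by_cases hs : s = start ∨ s = detour ∨ s = choice
  · exact progress_of_rank (by simp [rank]) (by simp [rank]) (by simp [rank]) (by simp [rank]) hs
  have key : ∀ k : ℕ, m < k ∨ max m k = m := fun k => by omega
  push Not at hs
  cases s <;> simp only [ne_eq, reduceCtorEq, not_true, not_false_eq_true, and_true, and_false] at hs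
  · cases i <;> simp_all [goodFor, Arena.sideValue, value, parityValue, -Nat.not_even_iff_odd]
  · refine ⟨two, by simp [arena], .inl ((key 2).resolve_right fun h => ?_)⟩
    cases i <;> simp_all [goodFor, Arena.sideValue, value, parityValue, -Nat.not_even_iff_odd]
  · refine ⟨three, by simp [arena], .inl ((key 3).resolve_right fun h => ?_)⟩
    cases i <;> simp_all [goodFor, Arena.sideValue, value, parityValue, -Nat.not_even_iff_odd]

lemma isCertificate_one :
    arena.IsCertificate Player.one (value choiceValue) (fun _ => rank 0) choose where
  nonneg m s := (value_mem choiceValue_mem m s).1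
  le_one m s := (value_mem choiceValue_mem m s).2
  avail := choose_mem_avail
  le_after m s a _ h := by rw [h rfl, after_choose]
  progress _ _ _ _ _ _ hg hp := progress hg hp

lemma isCertificate_two :
    arena.IsCertificate Player.two (Arena.sideValue (value choiceValue) Player.two)
      (fun _ => rank 0) choose where
  nonneg m s := sub_nonneg.2 (value_mem choiceValue_mem m s).2
  le_one m s := sub_le_self _ (value_mem choiceValue_mem m s).1
  avail := choose_mem_avail
  le_after m s a _ _ := by
    rw [Arena.sideValue, Arena.after_one_sub]
    exact sub_le_sub_left (after_le_value m s a) 1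
  progress _ _ _ _ _ _ hg hp := progress hg hp

lemma value_start : value choiceValue 0 start = 3 / 4 := by
  have h2 : Even 2 := even_two
  have h3 : ¬ Even 3 := by decide
  norm_num [value, choiceValue, parityValue, h2, h3]

lemma outcome_eq (s : CoinState) (σ₁ σ₂ : Strat CoinState Bool) :
    arena.outcome s σ₁ σ₂ weakParity = ENNReal.ofReal
      ((arena.playMeasure s σ₁ σ₂).real (arena.winEvent Player.one s 0)) := by
  have := arena.outcome_map_prepend s σ₁ σ₂ []
  rw [prepend_nil, Measure.map_id] at this
  rw [this, ofReal_measureReal]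
  rfl

/-- The optimal strategy, which remembers the greatest color seen, wins with probability `3 / 4`. -/
lemma outcome_playStrat {σ₂ : Strat CoinState Bool}
    (h₂ : arena.IsStrategy {start} Player.two σ₂) :
    arena.outcome start (arena.playStrat 0 choose) σ₂ weakParity = 3 / 4 := by
  have h₁ := (arena.playStrat_mem_strategies choose_mem_avail 0 StratType.general {start}
    Player.one).1
  have k1 := isCertificate_one.le_measureReal_winEvent arena (u := []) h₁ h₂
    (arena.playStrat_follows _ _ _ _)
  -- Player two owns no state, hence follows `choose` vacuously with any strategy; the dual
  -- certificate gives the upper bound.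
  have k2 := isCertificate_two.le_measureReal_winEvent arena (u := []) h₁ h₂
    (fun _ _ h => by cases h)
  rw [Arena.measureReal_winEvent_two] at k2
  simp only [Arena.sideValue, List.foldl_nil, value_start] at k1 k2
  rw [outcome_eq, le_antisymm (by linarith) k1,
    ENNReal.ofReal_div_of_pos (by norm_num)]
  norm_num

/-- A potential for the probability that player two wins, if player one plays `true` at `choice`
with probability `x`. -/
lemma potential_le {x ε : ℝ} (hε : 0 < ε) (hx0 : 0 ≤ x) (m : ℕ) (s : CoinState) :
    let c := fun m => x * parityValue m +
      (1 - x) * ((parityValue (max m 2) + parityValue (max m 3)) / 2)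
    let w := fun m s => 1 - value c m s - ε * rank m s
    w m s + (if Even m ∧ 0 < w m s then ε else 0) ≤
      if s = choice then x * arena.after w m choice true + (1 - x) * arena.after w m choice false
      else arena.after w m s true := by
  intro c w
  have hif : (if Even m ∧ 0 < w m s then ε else 0) ≤ ε := by split_ifs <;> linarith
  have key : ∀ k : ℕ, m < k ∨ max m k = m := fun k => by omega
  cases s
  · refine (add_le_add_right hif _).trans ?_
    simp only [reduceCtorEq, if_false, after_start, w, value, max_one_max_two, rank]
    push_cast
    linarith
  · refine (add_le_add_right hif _).trans ?_
    simp only [reduceCtorEq, if_false, after_detour, w, value, rank]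
    push_cast
    linarith
  · refine (add_le_add_right hif _).trans ?_
    simp only [if_true, after_choice_true, after_choice_false, w, value, rank, c]
    split_ifs <;> push_cast <;> nlinarith
  · simp only [reduceCtorEq, if_false, after_halt]
    -- Stopping with an even maximum is lost for player two, so the potential is 0 there and no
    -- growth is required.
    rw [if_neg, add_zero]
    rintro ⟨hm, h⟩
    simp [w, value, rank, parityValue, hm] at h
  · simp only [reduceCtorEq, if_false, after_two]
    rw [if_neg, add_zero]
    · simp [w, value, rank]
    · rintro ⟨hm, h⟩
      have : Even (max m 2) := by rcases max_choice m 2 with h | h <;> rw [h]; exacts [hm, even_two]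
      simp [w, value, rank, parityValue, this] at h
  · simp only [reduceCtorEq, if_false, after_three]
    rcases key 3 with h3 | h3
    · refine (add_le_add_right hif _).trans ?_
      simp [w, value, rank, h3]
    · have hlt : ¬ m < 3 := by omega
      rw [if_neg, h3, add_zero]
      rintro ⟨hm, h⟩
      simp [w, value, rank, parityValue, h3, hlt, hm] at h

/-- Memoryless strategies win with probability at most `1 / 2`. -/
lemma outcome_memoryless_le {σ₁ σ₂ : Strat CoinState Bool}
    (h₁ : arena.IsStrategy {start} Player.one σ₁) (h₂ : arena.IsStrategy {start} Player.two σ₂)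
    (hm : arena.IsMemoryless {start} Player.one σ₁) :
    arena.outcome start σ₁ σ₂ weakParity ≤ ENNReal.ofReal (1 / 2) := by
  classical
  -- The shortest history reaching `choice`, without the detour, fixes the distribution that a
  -- memoryless strategy uses there after every history.
  set q := σ₁ start [Move.of true choice]
  have hq : ∀ l, arena.IsPath start l → lastState start l = choice →
      arena.mover σ₁ σ₂ start l = q := fun l hl he =>
    hm _ _ _ _ ⟨rfl, hl, rfl⟩ ⟨rfl, ⟨true_mem_avail _, coin_left_pos _ _, trivial⟩, rfl⟩ he
  set x := (q true).toReal
  have hx0 : 0 ≤ x := ENNReal.toReal_nonneg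
  have hsum : x + (q false).toReal = 1 := by
    have := sum_toReal_pmf q
    rwa [Fintype.sum_bool] at this
  have hfalse : (q false).toReal = 1 - x := by linarith
  have hx1 : x ≤ 1 := by
    have : 0 ≤ (q false).toReal := ENNReal.toReal_nonneg
    linarith
  have main : ∀ ε, 0 < ε → 1 / 2 - ε * 4 ≤
      (arena.playMeasure start σ₁ σ₂).real (arena.winEvent Player.two start 0) := by
    intro ε hε
    let c := fun m => x * parityValue m +
      (1 - x) * ((parityValue (max m 2) + parityValue (max m 3)) / 2)
    let w := fun m s => 1 - value c m s - ε * rank m s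
    have hc : ∀ m, 0 ≤ c m ∧ c m ≤ 1 := fun m => by
      have h1 := parityValue_mem m
      have h2 := parityValue_mem (max m 2)
      have h3 := parityValue_mem (max m 3)
      constructor <;> simp only [c] <;> nlinarith
    let U : List (Move CoinState Bool) → ℝ := fun l =>
      w (arena.maxHist start 0 l) (lastState start l)
    have hloc : ∀ l, arena.IsPath start l →
        U l + (if Even (arena.maxHist start 0 l) ∧ 0 < U l then ε else 0) ≤
        expect (arena.mover σ₁ σ₂ start l) fun a =>
          expect (arena.δ (lastState start l) a) fun t => U (l ++ [Move.of a t]) := by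
      intro l hl
      refine (potential_le hε hx0 (arena.maxHist start 0 l) (lastState start l)).trans ?_
      simp only [U, Arena.lastState_concat, Arena.maxHist_concat]
      change _ ≤ expect (arena.mover σ₁ σ₂ start l) fun a =>
        arena.after w (arena.maxHist start 0 l) (lastState start l) a
      split_ifs with hs
      · rw [hq l hl hs, expect_eq_sum, Fintype.sum_bool, hfalse, hs]
      · refine le_expect fun a ha => ?_
        rw [eq_true_of_mem_avail hs (arena.mover_support h₁ h₂ hl ha)]
    -- At `choice`, player one wins with probability `(1 - x) / 2` after maximum 1 and `x + (1 - x)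
    -- / 2` after maximum 2, which average to 1/2 whatever `x` is. The 4 is the rank of `start`.
    have hU0 : U [] = 1 / 2 - ε * 4 := by
      have h2 : Even 2 := even_two
      have h3 : ¬ Even 3 := by decide
      simp only [U, w, c, Arena.maxHist_nil, Arena.lastState_nil, value, rank]
      norm_num [parityValue, h2, h3]
      ring
    rw [← hU0]
    refine arena.le_measureReal_of_certificate h₁ h₂ U
      (fun l => goodFor Player.two (arena.maxHist start 0 l)) hε (fun l _ => ?_) (fun l hl => ?_)
      (fun l hl hgood hpos => ?_) (arena.measurableSet_winEvent Player.two start [])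
      (arena.eventually_goodFor_iff Player.two start [])
    · have h1 := (value_mem hc (arena.maxHist start 0 l) (lastState start l)).1
      have h2 : 0 ≤ ε * (rank (arena.maxHist start 0 l) (lastState start l) : ℝ) := by positivity
      simp only [U, w]
      linarith
    · refine le_trans ?_ (hloc l hl)
      split_ifs <;> linarith
    · refine le_trans ?_ (hloc l hl)
      rw [if_pos ⟨not_not.1 hgood, hpos⟩]
  have hhalf : 1 / 2 ≤
      (arena.playMeasure start σ₁ σ₂).real (arena.winEvent Player.two start 0) := by
    refine le_of_forall_pos_le_add fun ε hε => ?_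
    linarith [main (ε / 4) (by positivity)]
  have h3 := arena.measureReal_winEvent_two start [] σ₁ σ₂
  rw [outcome_eq]
  refine ENNReal.ofReal_le_ofReal ?_
  simp only [List.foldl_nil] at h3
  linarith

lemma isInitialized : arena.IsInitialized {start} := by
  refine ⟨⟨start, rfl⟩, fun t => ⟨start, rfl, ?_⟩⟩
  have hc : arena.IsPath start [Move.of true choice] :=
    ⟨true_mem_avail _, coin_left_pos _ _, trivial⟩
  have happ : ∀ (a : Bool) (t : CoinState), 0 < arena.δ choice a t →
      ∃ l, arena.IsPath start l ∧ lastState start l = t := fun a t ht =>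
    ⟨[Move.of true choice] ++ [Move.of a t],
      (arena.isPath_concat _ _ _ _).2 ⟨hc, Set.mem_univ _, ht⟩, rfl⟩
  cases t
  · exact ⟨[], trivial, rfl⟩
  · exact ⟨[Move.of true detour], ⟨true_mem_avail _, coin_right_pos _ _, trivial⟩, rfl⟩
  · exact ⟨_, hc, rfl⟩
  · exact happ true _ (by simp [arena])
  · exact happ false _ (coin_left_pos _ _)
  · exact happ false _ (coin_right_pos _ _)

/-- The outcome of `σ₁` against any strategy of player two belongs to its own upper set. Optimality
would put it in the upper set of the strategy with memory, forcing `3 / 4 ≤ 1 / 2`. -/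
theorem not_isOptimal_of_isMemoryless {σ₁ : Strat CoinState Bool}
    (h₁ : arena.IsStrategy {start} Player.one σ₁)
    (hm : arena.IsMemoryless {start} Player.one σ₁) :
    ¬ arena.IsOptimal (prefOf weakParity) StratType.general {start} Player.one σ₁ := by
  intro hopt
  have hstrat := arena.playStrat_mem_strategies choose_mem_avail 0 StratType.general {start}
  have hsub := hopt.2 _ (hstrat Player.one) start rfl
  have hprob : IsProbabilityMeasure (arena.outcome start σ₁ (arena.playStrat 0 choose)) :=
    Measure.isProbabilityMeasure_map (arena.measurable_colPlay start).aemeasurable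
  obtain ⟨-, σ₂, hσ₂, hle⟩ := hsub ⟨hprob, _, hstrat Player.two, le_refl _⟩
  have h := hle.trans (outcome_memoryless_le h₁ (hstrat Player.two).1 hm)
  rw [outcome_playStrat hσ₂.1, ENNReal.ofReal_div_of_pos (by norm_num)] at h
  have h' := ENNReal.toReal_mono (by norm_num) h
  norm_num at h'

end CoinState

end WeakParityGame

theorem mainTheorem4 :
    -- deterministic arenas: pure memoryless strategies
    (∀ (S : Type u) (A : Type v) [Finite S] [Finite A] (G : Arena S A) (I : Set S),
      G.IsInitialized I → G.IsDeterministic → ∀ i : Player,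
        ∃ σ : Strat S A, G.IsPure I i σ ∧ G.IsMemoryless I i σ ∧
          ∀ X : StratType,
            G.IsOptimal (prefOf weakParity) X I i σ ∧
            G.IsSubgamePerfect (prefOf weakParity) X I i σ) ∧
    -- stochastic arenas: pure strategies remembering the greatest color seen
    (∀ (S : Type u) (A : Type v) [Finite S] [Finite A] (G : Arena S A) (I : Set S),
      G.IsInitialized I → ∀ i : Player,
        ∃ σ : Strat S A, G.IsPure I i σ ∧ G.IsBasedOn maxSkeleton I i σ ∧
          G.IsOptimal (prefOf weakParity) StratType.general I i σ ∧
          G.IsSubgamePerfect (prefOf weakParity) StratType.general I i σ) ∧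
    -- memoryless strategies, even randomized, do not suffice in stochastic arenas
    (∃ (S A : Type) (_ : Finite S) (_ : Finite A) (G : Arena S A) (s : S),
      G.IsInitialized {s} ∧ G.IsOnePlayer Player.one ∧
      (∃ σ₁ : Strat S A, G.IsStrategy {s} Player.one σ₁ ∧ G.IsPure {s} Player.one σ₁ ∧
        G.IsBasedOn maxSkeleton {s} Player.one σ₁ ∧
        ∀ σ₂ : Strat S A, G.IsStrategy {s} Player.two σ₂ →
          G.outcome s σ₁ σ₂ weakParity = 3 / 4) ∧
      ∀ σ₁ : Strat S A, G.IsStrategy {s} Player.one σ₁ → G.IsMemoryless {s} Player.one σ₁ →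
        ¬ G.IsOptimal (prefOf weakParity) StratType.general {s} Player.one σ₁) := by
  refine ⟨fun S A _ _ G I _ hG i => hG.exists_optimal_memoryless I i,
    fun S A _ _ G I _ i => G.exists_optimal_basedOn_maxSkeleton I i,
    CoinState, Bool, inferInstance, inferInstance, CoinState.arena, CoinState.start,
    CoinState.isInitialized, fun s hs => absurd rfl hs,
    ⟨CoinState.arena.playStrat 0 CoinState.choose, ?_, ?_, ?_,
      fun σ₂ h₂ => CoinState.outcome_playStrat h₂⟩,
    fun σ₁ h₁ hm => CoinState.not_isOptimal_of_isMemoryless h₁ hm⟩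
  · exact (CoinState.arena.playStrat_mem_strategies CoinState.choose_mem_avail 0
      StratType.general _ _).1
  · exact (CoinState.arena.playStrat_mem_strategies CoinState.choose_mem_avail 0
      StratType.pure _ _).2 rfl
  · refine ⟨fun s m => PMF.pure (CoinState.choose m s), fun s m _ => ?_, fun s l _ => rfl⟩
    rw [PMF.support_pure, Set.singleton_subset_iff]
    exact CoinState.choose_mem_avail m s
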